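/- Let $\Omega\subset\mathbb R^k$ be a bounded open set and let $\mathcal L=\sum_{|a|\le 2m}p_a(x)\,\partial^a$, $m\ge 1$, be a strongly elliptic differential operator of order $2m$ with real coefficients $p_a\in C^{|a|+m}(\overline\Omega)$, i.e. there is $c>0$ with $(-1)^m\sum_{|a|=2m}p_a(x)\xi^a\ge c|\xi|^{2m}$ for all $x\in\Omega$, $\xi\in\mathbb R^k$. Let a homogeneous linear boundary condition be given by a linear subspace $V\subset L^2(\Omega)$ (for the Dirichlet condition, $V=H^m_0(\Omega)$), and suppose that $\mathcal L$ with domain $H^{2m}(\Omega)\cap V$ is self-adjoint in the real Hilbert space $L^2(\Omega)$. Let $0<\mu_1<\mu_2<\cdots$ be the eigenvalues of $\mathcal L$, with finite multiplicities $1\le d_n\le D$, and let $\phi_{n,l}$ ($n\ge1$, $1\le l\le d_n$), with $\mathcal L\phi_{n,l}=\mu_n\phi_{n,l}$, be corresponding eigenfunctions forming a complete orthonormal basis of $L^2(\Omega)$. Assume that for some $M>0$, $\beta>1$, $\sigma\in(0,1]$, $\theta>0$, $s\ge0$, $$\mu_n=Mn^\beta\bigl(1+o(n^{-\sigma})\bigr)\quad(n\to\infty),\qquad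 \mu_{n+1}-\mu_n\ge\theta n^{-s}\quad(n\ge1).$$ Let $g_1,\dots,g_D\in L^2(\Omega)$, $g_j=\sum_{n\ge1}\sum_{l=1}^{d_n}b^n_{jl}\phi_{n,l}$, let $B_n=(b^n_{jl})\in\mathbb R^{D\times d_n}$ and let $B_n^\dagger$ be its Moore–Penrose inverse. Assume that every $B_n$ has full rank $d_n$ and that, with constants $L,p\in\mathbb R$ and $\alpha\in[0,\beta)$, $$\|B_n^\dagger\|\le L\,e^{p n^\alpha}\qquad(n\ge1),$$ where $\|\cdot\|$ is the spectral norm. Let $0<T\le\infty$ and $f\in L^2(\Omega)$, and let $u_j$ and $w$ be the solutions of $\partial_t u=-\mathcal L u$, $0<t\le T$, under the given boundary condition, with $u_j(\cdot,0)=g_j$ and $w(\cdot,0)=f$; that is, they are continuous functions of $t\in[0,T]$ ($t\in[0,\infty)$ if $T=\infty$) with values in $L^2(\Omega)$ which for $0<t\le T$ are differentiable in $t$, lie in the domain of $\mathcal L$ and satisfy the equation. Then for all real $0\le t_0<t_1\le T$ and all real $\tau$ with $t_0<\tau\le T$ there exist $\nu_1,\dots,\nu_D\in L^2[t_0,t_1]$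 such that each $t\mapsto\nu_j(t)u_j(\cdot,t)$ is integrable on $[t_0,t_1]$ with values in $L^2(\Omega)$, and $$w(\cdot,\tau)=\sum_{j=1}^D\int_{t_0}^{t_1}u_j(\cdot,t)\,\nu_j(t)\,dt\quad\text{in }L^2(\Omega).$$ -/

import Mathlib

open MeasureTheory Filter Topology
open scoped Distributions LineDeriv Matrix.Norms.L2Operator

noncomputable section

namespace EllipticEvolution

/-- The real Hilbert space `L²(Ω)` of an open set `Ω ⊆ ℝᵏ` with Lebesgue measure. -/
abbrev L2 {k : ℕ} (Ω : TopologicalSpace.Opens (EuclideanSpace ℝ (Fin k))) : Type :=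
  Lp ℝ 2 ((volume : Measure (EuclideanSpace ℝ (Fin k))).restrict (Ω : Set _))

/-- The multi-indices `a ∈ ℕᵏ` with `|a| = a₁ + ⋯ + a_k ≤ N`. -/
def multiIndices (k N : ℕ) : Finset (Fin k → ℕ) :=
  (Finset.Icc 0 (fun _ => N)).filter (fun a => ∑ i, a i ≤ N)

theorem mem_multiIndices {k N : ℕ} {a : Fin k → ℕ} :
    a ∈ multiIndices k N ↔ ∑ i, a i ≤ N := by
  simp only [multiIndices, Finset.mem_filter, Finset.mem_Icc, and_iff_right_iff_imp]
  intro h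
  refine ⟨fun i => Nat.zero_le _, fun i => ?_⟩
  exact (Finset.single_le_sum (fun j _ => Nat.zero_le (a j)) (Finset.mem_univ i)).trans h

/-- The partial derivative `∂ᵃψ` of a test function `ψ ∈ C_c^∞(Ω)`. -/
def multiDeriv {k : ℕ} {Ω : TopologicalSpace.Opens (EuclideanSpace ℝ (Fin k))}
    (a : Fin k → ℕ) (ψ : 𝓓(Ω, ℝ)) : 𝓓(Ω, ℝ) :=
  (List.finRange k).foldr
    (fun i h => (fun g : 𝓓(Ω, ℝ) => ∂_{(EuclideanSpace.single i 1 : EuclideanSpace ℝ (Fin k))} g)^[a i] h)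
    ψ

/-- `v ∈ L²(Ω)` is the weak derivative `∂ᵃu` of `u ∈ L²(Ω)`. -/
def IsWeakDeriv {k : ℕ} {Ω : TopologicalSpace.Opens (EuclideanSpace ℝ (Fin k))}
    (a : Fin k → ℕ) (u v : L2 Ω) : Prop :=
  ∀ ψ : 𝓓(Ω, ℝ),
    ∫ x in (Ω : Set _), u x * multiDeriv a ψ x = (-1) ^ (∑ i, a i) * ∫ x in (Ω : Set _), v x * ψ x

theorem integrable_mul_test {k : ℕ} {Ω : TopologicalSpace.Opens (EuclideanSpace ℝ (Fin k))}
    (u : L2 Ω) (ψ : 𝓓(Ω, ℝ)) :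
    Integrable (fun x => u x * ψ x) (volume.restrict (Ω : Set _)) := by
  have h1 : MemLp (fun x => ψ x) 2 (volume.restrict (Ω : Set (EuclideanSpace ℝ (Fin k)))) :=
    (ψ.continuous.memLp_of_hasCompactSupport ψ.hasCompactSupport).restrict _
  exact (Lp.memLp u).integrable_mul h1

theorem IsWeakDeriv.add {k : ℕ} {Ω : TopologicalSpace.Opens (EuclideanSpace ℝ (Fin k))}
    {a : Fin k → ℕ} {u v u' v' : L2 Ω} (h : IsWeakDeriv a u v) (h' : IsWeakDeriv a u' v') :
    IsWeakDeriv a (u + u') (v + v') := by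
  intro ψ
  have key : ∀ (w w' : L2 Ω) (χ : 𝓓(Ω, ℝ)), ∫ x in (Ω : Set _), (w + w') x * χ x
      = (∫ x in (Ω : Set _), w x * χ x) + ∫ x in (Ω : Set _), w' x * χ x := by
    intro w w' χ
    rw [← integral_add (integrable_mul_test w χ) (integrable_mul_test w' χ)]
    refine integral_congr_ae ?_
    filter_upwards [Lp.coeFn_add w w'] with x hx
    rw [hx, Pi.add_apply, add_mul]
  rw [key, key, h ψ, h' ψ, mul_add]

theorem IsWeakDeriv.smul {k : ℕ} {Ω : TopologicalSpace.Opens (EuclideanSpace ℝ (Fin k))}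
    {a : Fin k → ℕ} {u v : L2 Ω} (c : ℝ) (h : IsWeakDeriv a u v) :
    IsWeakDeriv a (c • u) (c • v) := by
  intro ψ
  have key : ∀ (w : L2 Ω) (χ : 𝓓(Ω, ℝ)), ∫ x in (Ω : Set _), (c • w) x * χ x
      = c * ∫ x in (Ω : Set _), w x * χ x := by
    intro w χ
    rw [← integral_const_mul]
    refine integral_congr_ae ?_
    filter_upwards [Lp.coeFn_smul c w] with x hx
    rw [hx, Pi.smul_apply, smul_eq_mul, mul_assoc]
  rw [key, key, h ψ]
  ring

theorem isWeakDeriv_zero {k : ℕ} {Ω : TopologicalSpace.Opens (EuclideanSpace ℝ (Fin k))}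
    (a : Fin k → ℕ) : IsWeakDeriv a (0 : L2 Ω) 0 := by
  have hz : ∀ χ : 𝓓(Ω, ℝ), ∫ x in (Ω : Set _), (0 : L2 Ω) x * χ x = 0 := by
    intro χ
    rw [← integral_zero (EuclideanSpace ℝ (Fin k)) ℝ (μ := volume.restrict (Ω : Set _))]
    refine integral_congr_ae ?_
    filter_upwards [Lp.coeFn_zero ℝ 2 (volume.restrict (Ω : Set (EuclideanSpace ℝ (Fin k))))]
      with x hx
    rw [hx, Pi.zero_apply, zero_mul]
  intro ψ
  rw [hz, hz, mul_zero]

/-- Weak derivatives are unique. -/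
theorem IsWeakDeriv.eq_zero {k : ℕ} {Ω : TopologicalSpace.Opens (EuclideanSpace ℝ (Fin k))}
    {a : Fin k → ℕ} {v : L2 Ω} (h : IsWeakDeriv a 0 v) : v = 0 := by
  have hv : ∀ ψ : 𝓓(Ω, ℝ), ∫ x in (Ω : Set _), v x * ψ x = 0 := by
    intro ψ
    have h1 := h ψ
    have h2 := isWeakDeriv_zero (Ω := Ω) a ψ
    rw [h2] at h1
    have h3 : ∫ x in (Ω : Set _), (0 : L2 Ω) x * ψ x = 0 := by
      rw [← integral_zero (EuclideanSpace ℝ (Fin k)) ℝ (μ := volume.restrict (Ω : Set _))]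
      refine integral_congr_ae ?_
      filter_upwards [Lp.coeFn_zero ℝ 2 (volume.restrict (Ω : Set (EuclideanSpace ℝ (Fin k))))]
        with x hx
      rw [hx, Pi.zero_apply, zero_mul]
    rw [h3, mul_zero] at h1
    exact (mul_eq_zero.mp h1.symm).resolve_left (pow_ne_zero _ (by norm_num))
  have hloc : LocallyIntegrableOn (fun x => v x) (Ω : Set (EuclideanSpace ℝ (Fin k))) volume := by
    intro x hx
    obtain ⟨s, hs, hsub, hcomp⟩ := exists_compact_subset Ω.isOpen hx
    refine ⟨s, mem_nhdsWithin_of_mem_nhds (mem_interior_iff_mem_nhds.mp hsub), ?_⟩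
    have hfin : IsFiniteMeasure ((volume : Measure (EuclideanSpace ℝ (Fin k))).restrict s) :=
      ⟨by simpa using hs.measure_lt_top⟩
    have hm : MemLp (fun x => v x) 2 (volume.restrict s) :=
      (Lp.memLp v).mono_measure (Measure.restrict_mono hcomp le_rfl)
    exact hm.integrable (by norm_num)
  have hae := Ω.isOpen.ae_eq_zero_of_integral_contDiff_smul_eq_zero hloc (by
    intro g hg hc hsupp
    have h4 := hv ⟨g, hg, hc, hsupp⟩
    have h5 : ∫ x in (Ω : Set _), g x • v x = 0 := by
      rw [← h4]
      refine integral_congr_ae (Eventually.of_forall fun x => ?_)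
      exact mul_comm _ _
    rw [← h5]
    refine (setIntegral_eq_integral_of_forall_compl_eq_zero ?_).symm
    intro x hx
    rw [image_eq_zero_of_notMem_tsupport (fun hx' => hx (hsupp hx')), zero_smul])
  refine Lp.ext ?_
  have h6 : ∀ᵐ x ∂(volume.restrict (Ω : Set (EuclideanSpace ℝ (Fin k)))), v x = 0 :=
    (ae_restrict_iff' Ω.isOpen.measurableSet).mpr hae
  filter_upwards [h6, Lp.coeFn_zero ℝ 2 (volume.restrict (Ω : Set (EuclideanSpace ℝ (Fin k))))]
    with x h7 h8
  rw [h7, h8, Pi.zero_apply]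

/-- `𝓛 = ∑_{|a| ≤ 2m} p_a(x) ∂ᵃ` is a strongly elliptic differential operator of order `2m` on `Ω`
with `p_a ∈ C^{|a| + m}` up to the boundary, i.e. all derivatives of `p_a` in `Ω` of order at most
`|a| + m` extend continuously to the closure of `Ω`. -/
structure IsStronglyElliptic {k : ℕ} (Ω : TopologicalSpace.Opens (EuclideanSpace ℝ (Fin k)))
    (m : ℕ) (p : (Fin k → ℕ) → EuclideanSpace ℝ (Fin k) → ℝ) : Prop where
  order_pos : 1 ≤ m
  contDiffOn : ∀ a ∈ multiIndices k (2 * m),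
    ContDiffOn ℝ ((∑ i, a i + m : ℕ) : ℕ∞) (p a) (Ω : Set _)
  extends_to_closure : ∀ a ∈ multiIndices k (2 * m), ∀ j ≤ ∑ i, a i + m,
    ∃ G, ContinuousOn G (closure (Ω : Set _)) ∧
      Set.EqOn (iteratedFDeriv ℝ j (p a)) G (Ω : Set _)
  elliptic : ∃ c > 0, ∀ x ∈ Ω, ∀ ξ : EuclideanSpace ℝ (Fin k),
    c * ‖ξ‖ ^ (2 * m) ≤
      (-1) ^ m * ∑ a ∈ multiIndices k (2 * m) with ∑ i, a i = 2 * m, p a x * ∏ i, ξ i ^ a i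

/-- The graph of the operator `u ↦ ∑_{|a| ≤ 2m} p_a ∂ᵃu` with domain `H^{2m}(Ω) ∩ V`, where the linear
subspace `V` of `L²(Ω)` encodes a homogeneous linear boundary condition. -/
def operatorGraph {k : ℕ} (Ω : TopologicalSpace.Opens (EuclideanSpace ℝ (Fin k))) (m : ℕ)
    (p : (Fin k → ℕ) → EuclideanSpace ℝ (Fin k) → ℝ) (V : Submodule ℝ (L2 Ω)) :
    Submodule ℝ (L2 Ω × L2 Ω) where
  carrier := {q | q.1 ∈ V ∧ ∃ v : (Fin k → ℕ) → L2 Ω,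
    (∀ a ∈ multiIndices k (2 * m), IsWeakDeriv a q.1 (v a)) ∧
    ∀ᵐ x ∂(volume.restrict (Ω : Set _)), q.2 x = ∑ a ∈ multiIndices k (2 * m), p a x * v a x}
  add_mem' := by
    rintro ⟨u, h⟩ ⟨u', h'⟩ ⟨hV, v, hv, hh⟩ ⟨hV', v', hv', hh'⟩
    refine ⟨V.add_mem hV hV', fun a => v a + v' a, fun a ha => (hv a ha).add (hv' a ha), ?_⟩
    have hadd : ∀ᵐ x ∂(volume.restrict (Ω : Set (EuclideanSpace ℝ (Fin k)))),
        ∀ a ∈ multiIndices k (2 * m), (v a + v' a) x = v a x + v' a x := by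
      rw [eventually_all_finset]
      intro a _
      filter_upwards [Lp.coeFn_add (v a) (v' a)] with x hx
      rw [hx, Pi.add_apply]
    filter_upwards [hh, hh', hadd, Lp.coeFn_add h h'] with x h1 h2 h3 h4
    change (h + h') x = _
    rw [h4, Pi.add_apply, h1, h2, ← Finset.sum_add_distrib]
    refine Finset.sum_congr rfl fun a ha => ?_
    rw [h3 a ha, mul_add]
  zero_mem' := by
    refine ⟨V.zero_mem, fun _ => 0, fun a _ => isWeakDeriv_zero a, ?_⟩
    filter_upwards [Lp.coeFn_zero ℝ 2 (volume.restrict (Ω : Set (EuclideanSpace ℝ (Fin k))))]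
      with x hx
    change (0 : L2 Ω) x = ∑ a ∈ multiIndices k (2 * m), p a x * (0 : L2 Ω) x
    rw [hx, Pi.zero_apply]
    exact (Finset.sum_eq_zero fun a _ => mul_zero _).symm
  smul_mem' := by
    rintro c ⟨u, h⟩ ⟨hV, v, hv, hh⟩
    refine ⟨V.smul_mem c hV, fun a => c • v a, fun a ha => (hv a ha).smul c, ?_⟩
    have hsm : ∀ᵐ x ∂(volume.restrict (Ω : Set (EuclideanSpace ℝ (Fin k)))),
        ∀ a ∈ multiIndices k (2 * m), (c • v a) x = c * v a x := by
      rw [eventually_all_finset]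
      intro a _
      filter_upwards [Lp.coeFn_smul c (v a)] with x hx
      rw [hx, Pi.smul_apply, smul_eq_mul]
    filter_upwards [hh, hsm, Lp.coeFn_smul c h] with x h1 h2 h3
    change (c • h) x = _
    rw [h3, Pi.smul_apply, h1, smul_eq_mul, Finset.mul_sum]
    refine Finset.sum_congr rfl fun a ha => ?_
    rw [h2 a ha]
    ring

/-- The differential operator `𝓛 u = ∑_{|a| ≤ 2m} p_a ∂ᵃu` in `L²(Ω)`, with domain
`H^{2m}(Ω) ∩ V`. -/
def operator {k : ℕ} (Ω : TopologicalSpace.Opens (EuclideanSpace ℝ (Fin k))) (m : ℕ)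
    (p : (Fin k → ℕ) → EuclideanSpace ℝ (Fin k) → ℝ) (V : Submodule ℝ (L2 Ω)) :
    L2 Ω →ₗ.[ℝ] L2 Ω :=
  (operatorGraph Ω m p V).toLinearPMap

/-- The graph of `operator` is the prescribed one. -/
theorem operator_graph {k : ℕ} (Ω : TopologicalSpace.Opens (EuclideanSpace ℝ (Fin k))) (m : ℕ)
    (p : (Fin k → ℕ) → EuclideanSpace ℝ (Fin k) → ℝ) (V : Submodule ℝ (L2 Ω)) :
    (operator Ω m p V).graph = operatorGraph Ω m p V := by
  refine Submodule.toLinearPMap_graph_eq _ ?_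
  rintro ⟨u, h⟩ ⟨-, v, hv, hh⟩ hu
  simp only at hu hh hv ⊢
  subst hu
  refine Lp.ext ?_
  have hz : ∀ᵐ x ∂(volume.restrict (Ω : Set (EuclideanSpace ℝ (Fin k)))),
      ∀ a ∈ multiIndices k (2 * m), v a x = 0 := by
    rw [eventually_all_finset]
    intro a ha
    rw [(hv a ha).eq_zero]
    filter_upwards [Lp.coeFn_zero ℝ 2 (volume.restrict (Ω : Set (EuclideanSpace ℝ (Fin k))))]
      with x hx
    rw [hx, Pi.zero_apply]
  filter_upwards [hh, hz, Lp.coeFn_zero ℝ 2 (volume.restrict (Ω : Set (EuclideanSpace ℝ (Fin k))))]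
    with x h1 h2 h3
  rw [h1, h3, Pi.zero_apply]
  exact Finset.sum_eq_zero fun a ha => by rw [h2 a ha, mul_zero]

/-- The class in `L²(Ω)` of a test function. -/
def testToL2 {k : ℕ} {Ω : TopologicalSpace.Opens (EuclideanSpace ℝ (Fin k))} (ψ : 𝓓(Ω, ℝ)) :
    L2 Ω :=
  MemLp.toLp (fun x => ψ x)
    ((ψ.continuous.memLp_of_hasCompactSupport ψ.hasCompactSupport).restrict _)

/-- The space `H₀ᵐ(Ω)`, the closure of `C_c^∞(Ω)` in `Hᵐ(Ω)`: the zeroth components of the limits in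
`∏_{|a| ≤ m} L²(Ω)` of families `(∂ᵃψ)_{|a| ≤ m}`. The choice `V = H₀ᵐ(Ω)` of a boundary condition is
the Dirichlet condition `∂ᵃu = 0` on `∂Ω` for `|a| ≤ m - 1`. -/
def dirichletCondition {k : ℕ} (Ω : TopologicalSpace.Opens (EuclideanSpace ℝ (Fin k))) (m : ℕ) :
    Submodule ℝ (L2 Ω) :=
  (Submodule.span ℝ (Set.range fun ψ : 𝓓(Ω, ℝ) =>
      fun a : {a // a ∈ multiIndices k m} => testToL2 (multiDeriv a.1 ψ))).topologicalClosure.map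
    (LinearMap.proj ⟨0, mem_multiIndices.mpr (by simp)⟩)

/-- `u` is the solution on `0 ≤ t ≤ T`, `T ≤ ∞`, of `∂ₜu = -A u` for `t > 0` and `u(·, 0) = f`; the
boundary condition is part of the domain of `A`. -/
structure IsSolution {H : Type*} [NormedAddCommGroup H] [InnerProductSpace ℝ H]
    (A : H →ₗ.[ℝ] H) (T : EReal) (f : H) (u : ℝ → H) : Prop where
  continuousOn : ContinuousOn u {t : ℝ | 0 ≤ t ∧ (t : EReal) ≤ T}
  initial : u 0 = f
  equation : ∀ t : ℝ, 0 < t → (t : EReal) ≤ T → ∃ h : u t ∈ A.domain,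
    HasDerivWithinAt u (-(A ⟨u t, h⟩)) {t : ℝ | 0 ≤ t ∧ (t : EReal) ≤ T} t

/-- `X` is the Moore–Penrose inverse of the real matrix `B`. -/
structure IsMoorePenroseInverse {ι κ : Type*} [Fintype ι] [Fintype κ]
    (B : Matrix ι κ ℝ) (X : Matrix κ ι ℝ) : Prop where
  mul_mul_self : B * X * B = B
  self_mul_mul : X * B * X = X
  symm_left : (B * X).transpose = B * X
  symm_right : (X * B).transpose = X * B

end EllipticEvolution

end

namespace EllipticEvolution

/-! ### Sequences of polynomial growth with polynomially separated terms -/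

/-! In the eigenbasis, self-adjointness gives `⟨φ_{n,l}, u_j(t)⟩ = e^{-μ_n t} b^n_{jl}`
(`inner_eq_of_isSolution`), and `B_n† B_n = 1` by full rank. With `r_n = f_n B_n†`, where `f_n` is
the row of coefficients of `f`, one has `r_n B_n = f_n`. It therefore suffices that each `ν_j` solve
the moment problem `∫ ν_j(t) e^{-μ_n (t - t₀)} dt = e^{-μ_n (τ - t₀)} r_{n,j}`. Its right-hand sides
decay like `e^{-(τ - t₀) μ_n}`, up to a factor `e^{p n^α}` with `α < β`.

The moment problem is first solved on `(t₀, ∞)`. There the exponentials have the Cauchy Gram matrix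
`1/(μ_i + μ_j)`, and Blaschke factors bound the norm of a biorthogonal family by products `∏ (μ_j +
μ_k)/|μ_j - μ_k|` (`exists_biorthogonal`). Growth and gaps make these `e^{O(k^γ)}` with `γ < β`
(`exists_prod_le_exp`), so `y = ∑ m_n ψ_n` converges.

To return to `(t₀, t₁)`, let `X` be the closed span of the exponentials, and let `R`, `G` restrict
`X` to `(t₀, t₁]` and `(t₁, ∞)`. Then `R*R = 1 - G*G`, `G` is compact because the exponentials
decay, and `R` is injective because elements of `X` are analytic (`eq_zero_of_restrictLp_eq_zero`).
By the Fredholm alternative `R*R` is invertible, and `ν = R z` with `R*R z` representing `y` on `X`.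
-/

theorem one_le_natCast_add_one (n : ℕ) : (1 : ℝ) ≤ (n : ℝ) + 1 := by
  have : (0 : ℝ) ≤ n := n.cast_nonneg
  linarith

/-- A positive sequence asymptotic to `M (n + 1) ^ β` is bounded above and below by multiples of
`(n + 1) ^ β`. -/
theorem exists_rpow_bounds {μ : ℕ → ℝ} (hpos : ∀ n, 0 < μ n) {M β : ℝ} (hM : 0 < M)
    (h : Tendsto (fun n : ℕ => μ n / (M * ((n : ℝ) + 1) ^ β)) atTop (𝓝 1)) :
    ∃ a > 0, ∃ b > 0, ∀ n : ℕ, a * ((n : ℝ) + 1) ^ β ≤ μ n ∧ μ n ≤ b * ((n : ℝ) + 1) ^ β := by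
  obtain ⟨C, hC⟩ := h.bddAbove_range
  obtain ⟨C', hC'⟩ := (h.inv₀ one_ne_zero).bddAbove_range
  have hx : ∀ n : ℕ, 0 < M * ((n : ℝ) + 1) ^ β := fun n => by positivity
  have hq : ∀ n : ℕ, 0 < μ n / (M * ((n : ℝ) + 1) ^ β) := fun n => div_pos (hpos n) (hx n)
  have h1 : ∀ n : ℕ, μ n / (M * ((n : ℝ) + 1) ^ β) ≤ C := fun n => hC ⟨n, rfl⟩
  have h2 : ∀ n : ℕ, (μ n / (M * ((n : ℝ) + 1) ^ β))⁻¹ ≤ C' := fun n => hC' ⟨n, rfl⟩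
  have hC0 : 0 < C := (hq 0).trans_le (h1 0)
  have hC0' : 0 < C' := (inv_pos.mpr (hq 0)).trans_le (h2 0)
  refine ⟨M / C', by positivity, C * M, by positivity, fun n => ⟨?_, ?_⟩⟩
  · have h3 := h2 n
    rw [inv_div, div_le_iff₀ (hpos n)] at h3
    rw [div_mul_eq_mul_div, div_le_iff₀ hC0']
    linarith
  · have h3 := h1 n
    rw [div_le_iff₀ (hx n)] at h3
    linarith

/-- By monotonicity the distance is at least the gap just above the smaller index, and the lower
bound for gaps decreases with the index. -/
theorem separation_of_gap {μ : ℕ → ℝ} (hmono : StrictMono μ) {θ s : ℝ} (hθ : 0 < θ) (hs : 0 ≤ s)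
    (hgap : ∀ n : ℕ, θ * ((n : ℝ) + 1) ^ (-s) ≤ μ (n + 1) - μ n) {N : ℝ} {i j : ℕ} (hij : i ≠ j)
    (hi : (i : ℝ) + 1 ≤ N) (hj : (j : ℝ) + 1 ≤ N) : θ * N ^ (-s) ≤ |μ i - μ j| := by
  wlog hlt : i < j generalizing i j
  · rw [abs_sub_comm]
    exact this hij.symm hj hi (by omega)
  have h1 : μ (i + 1) ≤ μ j := hmono.monotone hlt
  have h2 := hgap i
  have h3 : N ^ (-s) ≤ ((i : ℝ) + 1) ^ (-s) :=
    Real.rpow_le_rpow_of_nonpos (by positivity) hi (by linarith)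
  have h4 := mul_le_mul_of_nonneg_left h3 hθ.le
  rw [abs_sub_comm]
  exact (by linarith : _ ≤ μ j - μ i).trans (le_abs_self _)

/-- Since `log x ≤ x ^ η / η`, polynomial factors cost only an arbitrarily small power in the
exponent. -/
theorem mul_rpow_le_exp {A q η x : ℝ} (hq : 0 ≤ q) (hA : 0 ≤ A) (hη : 0 < η) (hx : 1 ≤ x) :
    A * x ^ q ≤ Real.exp ((A + q / η) * x ^ η) := by
  have hx0 : 0 < x := by linarith
  have h1 : (1 : ℝ) ≤ x ^ η := Real.one_le_rpow hx hη.le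
  have h2 : A ≤ Real.exp (A * x ^ η) :=
    ((le_mul_of_one_le_right hA h1).trans (by linarith)).trans (Real.add_one_le_exp _)
  have h3 : x ^ q ≤ Real.exp (q / η * x ^ η) := by
    rw [Real.rpow_def_of_pos hx0, Real.exp_le_exp]
    have := mul_le_mul_of_nonneg_right (Real.log_le_rpow_div hx0.le hη) hq
    calc _ ≤ _ := this
      _ = _ := by ring
  rw [add_mul, Real.exp_add]
  gcongr

/-- The products `∏ (μ_j + μ_k) / |μ_j - μ_k|` over finite sets of indices `j ≠ k` are at most
`exp (o(μ_k))`. -/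
theorem exists_prod_le_exp {μ : ℕ → ℝ} (hpos : ∀ n, 0 < μ n) (hmono : StrictMono μ)
    {a b β : ℝ} (ha : 0 < a) (hb : 0 < b) (hβ : 1 < β)
    (hab : ∀ n : ℕ, a * ((n : ℝ) + 1) ^ β ≤ μ n ∧ μ n ≤ b * ((n : ℝ) + 1) ^ β)
    {θ s : ℝ} (hθ : 0 < θ) (hs : 0 ≤ s)
    (hgap : ∀ n : ℕ, θ * ((n : ℝ) + 1) ^ (-s) ≤ μ (n + 1) - μ n) :
    ∃ γ < β, ∃ Λ : ℝ, ∀ (k : ℕ) (G : Finset ℕ), k ∉ G →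
      ∏ j ∈ G, (μ j + μ k) / |μ j - μ k| ≤ Real.exp (Λ * ((k : ℝ) + 1) ^ γ) := by
  -- Any `η > 0` with `1 + η < β` would do: near and far factors both contribute `x ^ (1 + η)` to
  -- the exponent.
  set η := (β - 1) / 2 with hηdef
  have hη : 0 < η := by rw [hηdef]; linarith
  have hγβ : 1 + η < β := by rw [hηdef]; linarith
  -- The cutoff is chosen so that `j + 1 ≥ K (k + 1)` forces `μ j ≥ 2 μ k`.
  obtain ⟨K, hK⟩ := exists_nat_ge (max 1 (2 * b / a))
  have hK1 : (1 : ℝ) ≤ K := (le_max_left _ _).trans hK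
  have hK2 : 2 * b ≤ a * K := by
    have := (le_max_right _ _).trans hK
    rwa [div_le_iff₀' ha] at this
  set A : ℝ := 2 * b * (K : ℝ) ^ β / (θ * (K : ℝ) ^ (-s)) with hAdef
  have hA : 0 ≤ A := by positivity
  set A' : ℝ := A + (β + s) / η with hA'def
  have hA' : 0 ≤ A' := by positivity
  have hsum : Summable fun j : ℕ => (((j + 1 : ℕ) : ℝ) ^ (1 + η))⁻¹ :=
    (summable_nat_add_iff 1).mpr (Real.summable_nat_rpow_inv.mpr (by linarith))
  set Z : ℝ := ∑' j : ℕ, (((j + 1 : ℕ) : ℝ) ^ (1 + η))⁻¹ with hZ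
  refine ⟨1 + η, hγβ, K * A' + 4 * (b / a) * Z, fun k G hkG => ?_⟩
  have hx1 : (1 : ℝ) ≤ (k : ℝ) + 1 := one_le_natCast_add_one k
  set x : ℝ := (k : ℝ) + 1 with hx
  have hx0 : 0 < x := by linarith
  have hratio : ∀ j, 0 ≤ (μ j + μ k) / |μ j - μ k| := fun j =>
    div_nonneg (add_nonneg (hpos j).le (hpos k).le) (abs_nonneg _)
  -- indices of the order of `k`
  have hnear : ∀ j ∈ G.filter (fun j => j + 1 < K * (k + 1)),
      (μ j + μ k) / |μ j - μ k| ≤ Real.exp (A' * x ^ η) := by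
    intro j hj
    rw [Finset.mem_filter] at hj
    have hjk : j ≠ k := fun h => hkG (h ▸ hj.1)
    have hjx : (j : ℝ) + 1 ≤ K * x := by rw [hx]; exact_mod_cast hj.2.le
    have hkx : (k : ℝ) + 1 ≤ K * x := le_mul_of_one_le_left hx0.le hK1
    have h1 := separation_of_gap hmono hθ hs hgap hjk hjx hkx
    have h2 : ∀ i : ℕ, (i : ℝ) + 1 ≤ K * x → μ i ≤ b * (K * x) ^ β := fun i hi =>
      (hab i).2.trans (by gcongr)
    have h3 : μ j + μ k ≤ 2 * b * (K * x) ^ β := by linarith [h2 j hjx, h2 k hkx]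
    refine le_trans ?_ (mul_rpow_le_exp (by linarith : 0 ≤ β + s) hA hη hx1)
    calc (μ j + μ k) / |μ j - μ k| ≤ (2 * b * (K * x) ^ β) / (θ * (K * x) ^ (-s)) := by
          gcongr
      _ = A * x ^ (β + s) := by
          rw [hAdef, Real.mul_rpow (by positivity) hx0.le, Real.mul_rpow (by positivity) hx0.le,
            Real.rpow_add hx0, Real.rpow_neg hx0.le s]
          field_simp
  -- With `q = μ k / μ j ≤ 1/2` the factor `(1 + q)/(1 - q)` is at most `1 + 4q ≤ e^{4q}`. Lowering
  -- the exponent from `β` to `1 + η > 1` keeps the bound for `q` summable in `j`.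
  have hfar : ∀ j ∈ G.filter (fun j => ¬ (j + 1 < K * (k + 1))),
      (μ j + μ k) / |μ j - μ k| ≤
        Real.exp (4 * (b / a) * x ^ (1 + η) * (((j + 1 : ℕ) : ℝ) ^ (1 + η))⁻¹) := by
    intro j hj
    rw [Finset.mem_filter, not_lt] at hj
    have hjx : K * x ≤ (j : ℝ) + 1 := by rw [hx]; exact_mod_cast hj.2
    have hxj : x ≤ (j : ℝ) + 1 := (le_mul_of_one_le_left hx0.le hK1).trans hjx
    have hy0 : (0 : ℝ) < (j : ℝ) + 1 := by linarith
    have h1 : 2 * μ k ≤ μ j := by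
      have h2 : (K : ℝ) ≤ (K : ℝ) ^ β := by
        simpa using Real.rpow_le_rpow_of_exponent_le hK1 hβ.le
      calc 2 * μ k ≤ 2 * (b * x ^ β) := by linarith [(hab k).2]
        _ = 2 * b * x ^ β := by ring
        _ ≤ a * (K : ℝ) ^ β * x ^ β := by
            have := hK2.trans (mul_le_mul_of_nonneg_left h2 ha.le)
            gcongr
        _ = a * (K * x) ^ β := by rw [Real.mul_rpow (by positivity) hx0.le]; ring
        _ ≤ a * ((j : ℝ) + 1) ^ β := by gcongr
        _ ≤ μ j := (hab j).1
    have h3 : μ k / μ j ≤ b / a * (x ^ (1 + η) * (((j + 1 : ℕ) : ℝ) ^ (1 + η))⁻¹) := by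
      calc μ k / μ j ≤ (b * x ^ β) / (a * ((j : ℝ) + 1) ^ β) := by
            gcongr
            · exact (hab k).2
            · exact (hab j).1
        _ = b / a * (x / ((j : ℝ) + 1)) ^ β := by
            rw [Real.div_rpow hx0.le hy0.le]; ring
        _ ≤ b / a * (x / ((j : ℝ) + 1)) ^ (1 + η) := by
            have := Real.rpow_le_rpow_of_exponent_ge (div_pos hx0 hy0)
              ((div_le_one hy0).mpr hxj) hγβ.le
            gcongr
        _ = _ := by rw [Real.div_rpow hx0.le hy0.le]; push_cast; ring
    have hk := hpos k
    have hjp := hpos j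
    rw [abs_of_pos (by linarith)]
    calc (μ j + μ k) / (μ j - μ k) ≤ 4 * (μ k / μ j) + 1 := by
          rw [div_le_iff₀ (by linarith)]
          have h4 : μ k / μ j * μ j = μ k := div_mul_cancel₀ _ hjp.ne'
          have h5 : μ k / μ j ≤ 1 / 2 := by rw [div_le_iff₀ hjp]; linarith
          nlinarith
      _ ≤ Real.exp (4 * (μ k / μ j)) := Real.add_one_le_exp _
      _ ≤ _ := by
          rw [Real.exp_le_exp]
          calc 4 * (μ k / μ j) ≤ 4 * (b / a * (x ^ (1 + η) * (((j + 1 : ℕ) : ℝ) ^ (1 + η))⁻¹)) := by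
                gcongr
            _ = _ := by ring
  rw [← Finset.prod_filter_mul_prod_filter_not G (fun j => j + 1 < K * (k + 1)), add_mul,
    Real.exp_add]
  -- At most `K x` near factors occur, each at most `exp (A' * x ^ η)`.
  have hcard : ((G.filter (fun j => j + 1 < K * (k + 1))).card : ℝ) ≤ K * x := by
    have : G.filter (fun j => j + 1 < K * (k + 1)) ⊆ Finset.range (K * (k + 1)) := by
      intro j hj
      rw [Finset.mem_filter] at hj
      exact Finset.mem_range.mpr (by omega)
    have := Finset.card_le_card this
    rw [Finset.card_range] at this
    rw [hx]
    exact_mod_cast this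
  refine mul_le_mul ?_ ?_ (Finset.prod_nonneg fun j _ => hratio j) (Real.exp_pos _).le
  · refine (Finset.prod_le_prod (fun j _ => hratio j) hnear).trans ?_
    rw [Finset.prod_const, ← Real.exp_nat_mul, Real.exp_le_exp]
    calc _ ≤ K * x * (A' * x ^ η) := by gcongr
      _ = K * A' * x ^ (1 + η) := by rw [Real.rpow_add hx0, Real.rpow_one]; ring
  · refine (Finset.prod_le_prod (fun j _ => hratio j) hfar).trans ?_
    rw [← Real.exp_sum, Real.exp_le_exp, ← Finset.mul_sum]
    have := hsum.sum_le_tsum (G.filter (fun j => ¬ (j + 1 < K * (k + 1))))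
      (fun j _ => by positivity)
    calc _ ≤ 4 * (b / a) * x ^ (1 + η) * Z := by gcongr
      _ = _ := by ring

/-- One third of `a n^β` eventually dominates each of `Λ n^γ`, `P n^α` and `n`, so the terms are
eventually below `e^{-n}`. -/
theorem summable_exp_rpow_sub_rpow {β γ α Λ P a : ℝ} (hβ : 1 < β) (hγ : γ < β) (hα : α < β)
    (ha : 0 < a) :
    Summable fun n : ℕ =>
      Real.exp (Λ * ((n : ℝ) + 1) ^ γ + P * ((n : ℝ) + 1) ^ α - a * ((n : ℝ) + 1) ^ β) := by
  have ht : Tendsto (fun n : ℕ => (n : ℝ) + 1) atTop atTop :=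
    tendsto_atTop_add_const_right _ _ tendsto_natCast_atTop_atTop
  have h0 : ∀ q < β, ∀ C : ℝ, ∀ᶠ x : ℝ in atTop, C * x ^ q ≤ a / 3 * x ^ β := by
    intro q hq C
    have h1 := (tendsto_rpow_neg_atTop (sub_pos.mpr hq)).const_mul C
    rw [mul_zero] at h1
    filter_upwards [h1.eventually_le_const (by positivity : 0 < a / 3), eventually_gt_atTop 0]
      with x hx hx0
    calc C * x ^ q = C * x ^ (-(β - q)) * x ^ β := by
          rw [mul_assoc, ← Real.rpow_add hx0]; congr 2; ring
      _ ≤ _ := by gcongr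
  refine summable_of_isBigO_nat Real.summable_exp_neg_nat (Asymptotics.IsBigO.of_bound 1 ?_)
  filter_upwards [ht.eventually (h0 γ hγ Λ), ht.eventually (h0 α hα P),
    ht.eventually (h0 1 hβ 1)] with n h1 h2 h3
  rw [Real.norm_of_nonneg (Real.exp_pos _).le, Real.norm_of_nonneg (Real.exp_pos _).le, one_mul,
    Real.exp_le_exp]
  rw [Real.rpow_one] at h3
  linarith

/-! ### Biorthogonal families in Hilbert spaces -/

section Biorthogonal

variable {H : Type*} [NormedAddCommGroup H] [InnerProductSpace ℝ H] {e : ℕ → H} {μ : ℕ → ℝ}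

/-- The vectors `e i` model `e^{-μ_i (t - t₀)}` in `L²(t₀, ∞)`; the estimates below need only their
Cauchy Gram matrix. -/
theorem norm_sq_sum_eq (he : ∀ i j, inner ℝ (e i) (e j) = 1 / (μ i + μ j)) (F : Finset ℕ)
    (c : ℕ → ℝ) :
    ‖∑ i ∈ F, c i • e i‖ ^ 2 = ∑ i ∈ F, ∑ j ∈ F, c i * c j / (μ i + μ j) := by
  rw [← real_inner_self_eq_norm_sq, sum_inner]
  refine Finset.sum_congr rfl fun i _ => ?_
  rw [inner_sum]
  refine Finset.sum_congr rfl fun j _ => ?_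
  rw [inner_smul_left, inner_smul_right, he]
  simp only [conj_trivial]
  ring

/-- Multiplying the coefficient of `e^{-μ_i t}` by the Blaschke factor `(μ_i - a) / (μ_i + a)` does
not increase the norm of an exponential sum. -/
theorem norm_sum_blaschke_le (hμ : ∀ i, 0 < μ i)
    (he : ∀ i j, inner ℝ (e i) (e j) = 1 / (μ i + μ j)) (F : Finset ℕ) (c : ℕ → ℝ) {a : ℝ}
    (ha : 0 < a) :
    ‖∑ i ∈ F, (c i * ((μ i - a) / (μ i + a))) • e i‖ ≤ ‖∑ i ∈ F, c i • e i‖ := by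
  rw [← sq_le_sq₀ (norm_nonneg _) (norm_nonneg _), norm_sq_sum_eq he,
    norm_sq_sum_eq he, ← sub_nonneg, ← Finset.sum_sub_distrib]
  -- Since `(μ_i + a)(μ_j + a) - (μ_i - a)(μ_j - a) = 2a(μ_i + μ_j)`, the denominator `μ_i + μ_j`
  -- cancels and the difference of the quadratic forms is a perfect square.
  have key : ∑ i ∈ F, (∑ j ∈ F, c i * c j / (μ i + μ j) -
      ∑ j ∈ F, c i * ((μ i - a) / (μ i + a)) * (c j * ((μ j - a) / (μ j + a))) / (μ i + μ j)) =
      2 * a * (∑ i ∈ F, c i / (μ i + a)) ^ 2 := by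
    rw [sq, Finset.sum_mul_sum, Finset.mul_sum]
    refine Finset.sum_congr rfl fun i _ => ?_
    rw [← Finset.sum_sub_distrib, Finset.mul_sum]
    refine Finset.sum_congr rfl fun j _ => ?_
    have h1 : μ i + μ j ≠ 0 := (add_pos (hμ i) (hμ j)).ne'
    have h2 : μ i + a ≠ 0 := (add_pos (hμ i) ha).ne'
    have h3 : μ j + a ≠ 0 := (add_pos (hμ j) ha).ne'
    field_simp
    ring
  rw [key]
  positivity

theorem norm_sum_prod_blaschke_le (hμ : ∀ i, 0 < μ i)
    (he : ∀ i j, inner ℝ (e i) (e j) = 1 / (μ i + μ j)) (F G : Finset ℕ) (c : ℕ → ℝ) :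
    ‖∑ i ∈ F, (c i * ∏ j ∈ G, ((μ i - μ j) / (μ i + μ j))) • e i‖ ≤ ‖∑ i ∈ F, c i • e i‖ := by
  induction G using Finset.induction_on with
  | empty => simp
  | insert k G hk ih =>
    refine le_trans (le_of_eq ?_) ((norm_sum_blaschke_le hμ he F _ (hμ k)).trans ih)
    congr 1
    refine Finset.sum_congr rfl fun i _ => ?_
    rw [Finset.prod_insert hk]
    congr 1
    ring

/-- The Blaschke product with zeros at the frequencies of `v` annihilates `v` and multiplies `e k`
by a factor whose inverse is at most `C` in modulus. -/
theorem norm_le_norm_sub_of_mem_span (hμ : ∀ i, 0 < μ i) (hinj : Function.Injective μ)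
    (he : ∀ i j, inner ℝ (e i) (e j) = 1 / (μ i + μ j)) {k : ℕ} {C : ℝ}
    (hC : ∀ G : Finset ℕ, k ∉ G → ∏ j ∈ G, (μ j + μ k) / |μ j - μ k| ≤ C) {v : H}
    (hv : v ∈ Submodule.span ℝ (e '' {j | j ≠ k})) : ‖e k‖ ≤ C * ‖e k - v‖ := by
  obtain ⟨l, hl, rfl⟩ := (Finsupp.mem_span_image_iff_linearCombination ℝ).mp hv
  set G := l.support with hG
  have hkG : k ∉ G := fun h => (Finsupp.mem_supported ℝ l).mp hl h rfl
  have h1 := norm_sum_prod_blaschke_le hμ he (insert k G) G (fun i => if i = k then 1 else -l i)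
  have h2 : ∑ i ∈ insert k G, (if i = k then 1 else -l i) • e i =
      e k - Finsupp.linearCombination ℝ e l := by
    rw [Finset.sum_insert hkG, if_pos rfl, one_smul, sub_eq_add_neg,
      Finsupp.linearCombination_apply, Finsupp.sum, ← Finset.sum_neg_distrib]
    congr 1
    refine Finset.sum_congr rfl fun i hi => ?_
    rw [if_neg (ne_of_mem_of_not_mem hi hkG), neg_smul]
  have h3 : ∑ i ∈ insert k G, ((if i = k then 1 else -l i) *
      ∏ j ∈ G, ((μ i - μ j) / (μ i + μ j))) • e i = (∏ j ∈ G, ((μ k - μ j) / (μ k + μ j))) • e k := by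
    rw [Finset.sum_insert hkG, if_pos rfl, one_mul, add_eq_left]
    refine Finset.sum_eq_zero fun i hi => ?_
    rw [Finset.prod_eq_zero hi (by rw [sub_self, zero_div]), mul_zero, zero_smul]
  rw [h2, h3, norm_smul] at h1
  have h4 : (∏ j ∈ G, (μ j + μ k) / |μ j - μ k|) *
      ‖∏ j ∈ G, ((μ k - μ j) / (μ k + μ j))‖ = 1 := by
    rw [Real.norm_eq_abs, Finset.abs_prod, ← Finset.prod_mul_distrib]
    refine Finset.prod_eq_one fun j hj => ?_
    have h5 : |μ j - μ k| ≠ 0 :=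
      abs_ne_zero.mpr (sub_ne_zero.mpr fun h => ne_of_mem_of_not_mem hj hkG (hinj h))
    have h6 : μ j + μ k ≠ 0 := (add_pos (hμ j) (hμ k)).ne'
    rw [abs_div, abs_sub_comm (μ k), add_comm (μ k), abs_of_pos (add_pos (hμ j) (hμ k))]
    field_simp
  have h7 : 0 ≤ ∏ j ∈ G, (μ j + μ k) / |μ j - μ k| := Finset.prod_nonneg fun j _ =>
    div_nonneg (add_pos (hμ j) (hμ k)).le (abs_nonneg _)
  calc ‖e k‖ = (∏ j ∈ G, (μ j + μ k) / |μ j - μ k|) *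
        (‖∏ j ∈ G, ((μ k - μ j) / (μ k + μ j))‖ * ‖e k‖) := by rw [← mul_assoc, h4, one_mul]
    _ ≤ _ := mul_le_mul (hC G hkG) h1 (by positivity) (h7.trans (hC G hkG))

/-- Take `ψ k = r / ‖r‖²`, with `r` the component of `e k` orthogonal to the other `e j`. Its norm
is the inverse of the distance from `e k` to their closed span. -/
theorem exists_biorthogonal [CompleteSpace H] (hμ : ∀ i, 0 < μ i) (hinj : Function.Injective μ)
    (he : ∀ i j, inner ℝ (e i) (e j) = 1 / (μ i + μ j)) {C : ℕ → ℝ}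
    (hC : ∀ (k : ℕ) (G : Finset ℕ), k ∉ G → ∏ j ∈ G, (μ j + μ k) / |μ j - μ k| ≤ C k) :
    ∃ ψ : ℕ → H, (∀ i j, inner ℝ (ψ i) (e j) = if i = j then 1 else 0) ∧
      ∀ i, ‖ψ i‖ * ‖e i‖ ≤ C i := by
  have hC0 : ∀ k, 0 < C k := fun k => one_pos.trans_le (by simpa using hC k ∅ (Finset.notMem_empty k))
  have hne : ∀ k, 0 < ‖e k‖ := fun k => by
    rw [norm_pos_iff, ← inner_self_ne_zero (𝕜 := ℝ), he]
    have := hμ k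
    positivity
  have main : ∀ k, ∃ ψ : H, (∀ j, inner ℝ ψ (e j) = if k = j then 1 else 0) ∧
      ‖ψ‖ * ‖e k‖ ≤ C k := by
    intro k
    set K := (Submodule.span ℝ (e '' {j | j ≠ k})).topologicalClosure with hK
    set r := e k - K.starProjection (e k) with hr
    have hmem : K.starProjection (e k) ∈ K := K.starProjection_apply_mem _
    have hb : ∀ v ∈ K, ‖e k‖ ≤ C k * ‖e k - v‖ := by
      intro v hv
      have hcl : IsClosed {v : H | ‖e k‖ ≤ C k * ‖e k - v‖} :=
        isClosed_le continuous_const (by fun_prop)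
      exact closure_minimal (fun v hv => norm_le_norm_sub_of_mem_span hμ hinj he (hC k) hv) hcl hv
    have hrb : ‖e k‖ ≤ C k * ‖r‖ := hb _ hmem
    have hr0 : 0 < ‖r‖ := pos_of_mul_pos_right ((hne k).trans_le hrb) (hC0 k).le
    have horth : ∀ v ∈ K, inner ℝ r v = 0 := fun v hv => K.starProjection_inner_eq_zero _ v hv
    have hrk : inner ℝ r (e k) = ‖r‖ ^ 2 := by
      rw [← real_inner_self_eq_norm_sq]
      conv_rhs => rw [hr, inner_sub_right, ← hr, horth _ hmem, sub_zero]
    refine ⟨(‖r‖ ^ 2)⁻¹ • r, fun j => ?_, ?_⟩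
    · rw [real_inner_smul_left]
      split_ifs with h
      · rw [← h, hrk]
        field_simp
      · rw [horth _ (Submodule.le_topologicalClosure _ (Submodule.subset_span ⟨j, Ne.symm h, rfl⟩)),
          mul_zero]
    · rw [norm_smul, norm_inv, norm_pow, norm_norm]
      calc (‖r‖ ^ 2)⁻¹ * ‖r‖ * ‖e k‖ = ‖e k‖ / ‖r‖ := by field_simp
        _ ≤ C k := by rwa [div_le_iff₀ hr0]
  choose ψ h1 h2 using main
  exact ⟨ψ, h1, h2⟩

/-- An operator `G` on the closed span of a sequence `e` with biorthogonal sequence `ψ` acts by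
the compact operator `x ↦ ∑ ⟨ψ_n, x⟩ G e_n` if `∑ ‖ψ_n‖ ‖G e_n‖ < ∞`. -/
theorem hasSum_apply_of_biorthogonal {Z : Type*} [NormedAddCommGroup Z] [NormedSpace ℝ Z]
    [CompleteSpace Z] {ψ : ℕ → H} (hψ : ∀ i j, inner ℝ (ψ i) (e j) = if i = j then 1 else 0)
    (G : H →L[ℝ] Z) (hs : Summable fun n => ‖ψ n‖ * ‖G (e n)‖) :
    ∃ S : H →L[ℝ] Z, HasSum (fun n => (innerSL ℝ (ψ n)).smulRight (G (e n))) S ∧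
      IsCompactOperator S ∧ ∀ x ∈ (Submodule.span ℝ (Set.range e)).topologicalClosure, S x = G x := by
  have hs' : Summable fun n => (innerSL ℝ (ψ n)).smulRight (G (e n)) := by
    refine Summable.of_norm ?_
    simpa only [ContinuousLinearMap.norm_smulRight_apply, innerSL_apply_norm] using hs
  refine ⟨_, hs'.hasSum, isCompactOperator_of_tendsto hs'.hasSum (Eventually.of_forall fun F => ?_),
    fun x hx => ?_⟩
  · refine (compactOperator (RingHom.id ℝ) H Z).sum_mem fun n _ => ?_
    have h1 : IsCompactOperator (innerSL ℝ (ψ n)) :=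
      isCompactOperator_of_locallyCompactSpace_dom (innerSL ℝ (ψ n))
    exact h1.clm_comp (ContinuousLinearMap.toSpanSingleton ℝ (G (e n)))
  set S := ∑' n, (innerSL ℝ (ψ n)).smulRight (G (e n)) with hS
  have hcl : IsClosed {x : H | S x = G x} := isClosed_eq S.continuous G.continuous
  refine closure_minimal (fun y hy => ?_) hcl hx
  have : Set.EqOn S G (Set.range e) := by
    rintro _ ⟨j, rfl⟩
    have h1 : HasSum (fun n => (innerSL ℝ (ψ n)).smulRight (G (e n)) (e j)) (S (e j)) :=
      hs'.hasSum.mapL (ContinuousLinearMap.apply ℝ Z (e j))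
    refine h1.unique ?_
    simp only [ContinuousLinearMap.smulRight_apply, innerSL_apply_apply, hψ]
    convert hasSum_ite_eq j (G (e j)) using 2 with n
    split_ifs with h
    · rw [h, one_smul]
    · rw [zero_smul]
  exact LinearMap.eqOn_span (f := S.toLinearMap) (g := G.toLinearMap) this hy

/-- If `H → Y × Z`, `x ↦ (R x, G x)`, is isometric, `G` is compact and `R` is injective, then every
bounded functional on `H` factors through `R`. -/
theorem exists_inner_eq_of_isCompactOperator {X Y Z : Type*} [NormedAddCommGroup X]
    [InnerProductSpace ℝ X] [CompleteSpace X] [NormedAddCommGroup Y] [InnerProductSpace ℝ Y]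
    [NormedAddCommGroup Z] [InnerProductSpace ℝ Z] [CompleteSpace Z] (R : X →L[ℝ] Y)
    (G : X →L[ℝ] Z) (hG : IsCompactOperator G)
    (hRG : ∀ x y, inner ℝ x y = inner ℝ (R x) (R y) + inner ℝ (G x) (G y))
    (hR : ∀ x, R x = 0 → x = 0) (y : X) : ∃ z : X, ∀ x, inner ℝ (R z) (R x) = inner ℝ y x := by
  set A : X →L[ℝ] X := (ContinuousLinearMap.adjoint G).comp G with hA
  have hcomp : IsCompactOperator A := hG.clm_comp (ContinuousLinearMap.adjoint G)
  have hinner : ∀ x z, inner ℝ (A x) z = inner ℝ (G x) (G z) := fun x z => by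
    rw [hA, ContinuousLinearMap.comp_apply, ContinuousLinearMap.adjoint_inner_left]
  -- `hRG` says `⟨(1 - A) x, z⟩ = ⟨R x, R z⟩`, so a fixed vector of `A` is killed by `R`. As `A` is
  -- compact, excluding the eigenvalue `1` makes `1 - A` invertible.
  have hres : (1 : ℝ) ∈ resolventSet ℝ A := by
    refine (hcomp.hasEigenvalue_or_mem_resolventSet one_ne_zero).resolve_left fun h => ?_
    obtain ⟨x, hx⟩ := h.exists_hasEigenvector
    have h1 : A x = x := by simpa using hx.apply_eq_smul
    have h2 := hRG x x
    rw [← hinner, h1, right_eq_add, inner_self_eq_zero] at h2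
    exact hx.2 (hR x h2)
  obtain ⟨U, hU⟩ := spectrum.mem_resolventSet_iff.mp hres
  refine ⟨(↑U⁻¹ : X →L[ℝ] X) y, fun x => ?_⟩
  set z := (↑U⁻¹ : X →L[ℝ] X) y with hz
  have h1 : z - A z = y := by
    have h2 : (U : X →L[ℝ] X) z = y := by
      rw [hz, ← mul_apply_eq_comp, U.mul_inv, one_apply_eq_self]
    rw [hU] at h2
    simpa using h2
  rw [← h1, inner_sub_left, hinner, hRG z x]
  ring

end Biorthogonal

/-! ### Real exponentials in `L²(t₀, ∞)` -/

theorem integral_exp_mul_sub_Ioi {a : ℝ} (ha : 0 < a) (t₀ b : ℝ) :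
    ∫ t in Set.Ioi b, Real.exp (-a * (t - t₀)) = Real.exp (-a * (b - t₀)) / a := by
  have h : ∀ t, Real.exp (-a * (t - t₀)) = Real.exp (a * t₀) * Real.exp (-a * t) := fun t => by
    rw [← Real.exp_add]; congr 1; ring
  simp_rw [h]
  rw [integral_const_mul, integral_exp_mul_Ioi (neg_neg_of_pos ha)]
  field_simp

theorem memLp_exp_mul_sub (t₀ : ℝ) {a : ℝ} (ha : 0 < a) :
    MemLp (fun t => Real.exp (-a * (t - t₀))) 2 (volume.restrict (Set.Ioi t₀)) := by
  rw [memLp_two_iff_integrable_sq (by fun_prop)]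
  have h : ∀ t, Real.exp (-a * (t - t₀)) ^ 2 = Real.exp (2 * a * t₀) * Real.exp (-(2 * a) * t) :=
    fun t => by rw [sq, ← Real.exp_add, ← Real.exp_add]; congr 1; ring
  simp_rw [h]
  exact (integrableOn_exp_mul_Ioi (by linarith) t₀).const_mul _

/-- The class of `t ↦ exp (-a (t - t₀))` in `L²(t₀, ∞)`. -/
noncomputable def expLp (t₀ : ℝ) {a : ℝ} (ha : 0 < a) : Lp ℝ 2 (volume.restrict (Set.Ioi t₀)) :=
  (memLp_exp_mul_sub t₀ ha).toLp _

/-- Restriction from `L²(t₀, ∞)` to `L²((t₀, ∞) ∩ s)`. -/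
noncomputable abbrev restrictLp (t₀ : ℝ) (s : Set ℝ) : Lp ℝ 2 (volume.restrict (Set.Ioi t₀)) →L[ℝ]
    Lp ℝ 2 ((volume.restrict (Set.Ioi t₀)).restrict s) :=
  LpToLpRestrictCLM ℝ ℝ ℝ (volume.restrict (Set.Ioi t₀)) 2 s

theorem restrict_restrict_Ioi {t₀ b : ℝ} (hb : t₀ ≤ b) :
    (volume.restrict (Set.Ioi t₀)).restrict (Set.Ioi b) = volume.restrict (Set.Ioi b) := by
  rw [Measure.restrict_restrict measurableSet_Ioi, Set.inter_eq_left.mpr (Set.Ioi_subset_Ioi hb)]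

theorem coeFn_expLp (t₀ : ℝ) {a : ℝ} (ha : 0 < a) :
    expLp t₀ ha =ᵐ[volume.restrict (Set.Ioi t₀)] fun t => Real.exp (-a * (t - t₀)) :=
  MemLp.coeFn_toLp _

theorem coeFn_restrictLp_expLp (t₀ : ℝ) (s : Set ℝ) {a : ℝ} (ha : 0 < a) :
    restrictLp t₀ s (expLp t₀ ha) =ᵐ[(volume.restrict (Set.Ioi t₀)).restrict s]
      fun t => Real.exp (-a * (t - t₀)) :=
  (LpToLpRestrictCLM_coeFn ℝ s _).trans (ae_restrict_of_ae (coeFn_expLp t₀ ha))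

theorem inner_restrictLp (t₀ : ℝ) (s : Set ℝ) (x y : Lp ℝ 2 (volume.restrict (Set.Ioi t₀))) :
    inner ℝ (restrictLp t₀ s x) (restrictLp t₀ s y) =
      ∫ t in s, inner ℝ (x t) (y t) ∂(volume.restrict (Set.Ioi t₀)) := by
  rw [L2.inner_def]
  refine integral_congr_ae ?_
  filter_upwards [LpToLpRestrictCLM_coeFn ℝ s x, LpToLpRestrictCLM_coeFn ℝ s y] with t h1 h2
  rw [h1, h2]

theorem inner_eq_add_inner_restrictLp (t₀ b : ℝ) (x y : Lp ℝ 2 (volume.restrict (Set.Ioi t₀))) :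
    inner ℝ x y = inner ℝ (restrictLp t₀ (Set.Iic b) x) (restrictLp t₀ (Set.Iic b) y) +
      inner ℝ (restrictLp t₀ (Set.Ioi b) x) (restrictLp t₀ (Set.Ioi b) y) := by
  have h := integral_add_compl (measurableSet_Iic : MeasurableSet (Set.Iic b))
    (L2.integrable_inner (𝕜 := ℝ) x y)
  rw [Set.compl_Iic] at h
  rw [inner_restrictLp, inner_restrictLp, L2.inner_def, h]

theorem inner_restrictLp_expLp {t₀ b : ℝ} (hb : t₀ ≤ b) {a a' : ℝ} (ha : 0 < a) (ha' : 0 < a') :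
    inner ℝ (restrictLp t₀ (Set.Ioi b) (expLp t₀ ha)) (restrictLp t₀ (Set.Ioi b) (expLp t₀ ha')) =
      Real.exp (-(a + a') * (b - t₀)) / (a + a') := by
  rw [L2.inner_def, ← integral_exp_mul_sub_Ioi (add_pos ha ha'), ← restrict_restrict_Ioi hb]
  refine integral_congr_ae ?_
  filter_upwards [coeFn_restrictLp_expLp t₀ (Set.Ioi b) ha,
    coeFn_restrictLp_expLp t₀ (Set.Ioi b) ha'] with t h1 h2
  rw [h1, h2, real_inner_eq_re_inner, RCLike.inner_apply]
  simp only [conj_trivial, RCLike.re_to_real]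
  rw [← Real.exp_add]
  congr 1
  ring

theorem inner_expLp (t₀ : ℝ) {a a' : ℝ} (ha : 0 < a) (ha' : 0 < a') :
    inner ℝ (expLp t₀ ha) (expLp t₀ ha') = 1 / (a + a') := by
  have h := integral_exp_mul_sub_Ioi (add_pos ha ha') t₀ t₀
  rw [sub_self, mul_zero, Real.exp_zero] at h
  rw [L2.inner_def, ← h]
  refine integral_congr_ae ?_
  filter_upwards [coeFn_expLp t₀ ha, coeFn_expLp t₀ ha'] with t h1 h2
  rw [h1, h2, real_inner_eq_re_inner, RCLike.inner_apply]
  simp only [conj_trivial, RCLike.re_to_real]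
  rw [← Real.exp_add]
  congr 1
  ring

/-- This exponential gain beats the growth of the biorthogonal family and so makes restriction to a
tail compact on the closed span. -/
theorem norm_restrictLp_expLp {t₀ b : ℝ} (hb : t₀ ≤ b) {a : ℝ} (ha : 0 < a) :
    ‖restrictLp t₀ (Set.Ioi b) (expLp t₀ ha)‖ = Real.exp (-(b - t₀) * a) * ‖expLp t₀ ha‖ := by
  rw [← sq_eq_sq₀ (norm_nonneg _) (by positivity), mul_pow, ← real_inner_self_eq_norm_sq,
    ← real_inner_self_eq_norm_sq, inner_restrictLp_expLp hb, inner_expLp, sq, ← Real.exp_add,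
    mul_one_div]
  congr 2
  ring

theorem norm_expLp_sq (t₀ : ℝ) {a : ℝ} (ha : 0 < a) : ‖expLp t₀ ha‖ ^ 2 = 1 / (2 * a) := by
  rw [← real_inner_self_eq_norm_sq, inner_expLp, two_mul]

/-! ### Uniqueness and pointwise convergence of Dirichlet series -/

section Dirichlet

variable {μ : ℕ → ℝ} {c : ℕ → ℝ} {t₀ b : ℝ}

/-- A Dirichlet series that converges absolutely at `b` and vanishes almost everywhere on an
interval `(b, t₁)` vanishes on `(b, ∞)`. -/
theorem tsum_exp_eq_zero_of_ae_eq_zero (hμ : ∀ n, 0 < μ n)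
    (hc : Summable fun n => |c n| * Real.exp (-(b - t₀) * μ n)) {t₁ : ℝ} (hb : b < t₁)
    (h : ∀ᵐ t ∂volume.restrict (Set.Ioo b t₁), ∑' n, c n * Real.exp (-μ n * (t - t₀)) = 0) :
    ∀ t > b, ∑' n, c n * Real.exp (-μ n * (t - t₀)) = 0 := by
  -- The series is holomorphic on the half-plane `Re z > b`, where the identity theorem applies.
  set U : Set ℂ := {z | b < z.re} with hU
  have hUo : IsOpen U := isOpen_lt continuous_const Complex.continuous_re
  have hUc : Convex ℝ U := convex_halfSpace_re_gt b
  set F : ℂ → ℂ := fun z => ∑' n, (c n : ℂ) * Complex.exp (-(μ n : ℂ) * (z - t₀)) with hF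
  have hFd : DifferentiableOn ℂ F U := by
    refine Complex.differentiableOn_tsum_of_summable_norm hc (fun n => by fun_prop) hUo ?_
    intro n z hz
    rw [norm_mul, Complex.norm_real, Complex.norm_exp, Real.norm_eq_abs]
    gcongr
    have h1 : (-(μ n : ℂ) * (z - t₀)).re = -μ n * (z.re - t₀) := by
      simp [Complex.mul_re]
    rw [h1]
    have h2 : b < z.re := hz
    nlinarith [hμ n]
  have hFr : ∀ t : ℝ, F t = ((∑' n, c n * Real.exp (-μ n * (t - t₀)) : ℝ) : ℂ) := fun t => by
    rw [hF, Complex.ofReal_tsum]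
    push_cast
    rfl
  have hcont : ContinuousOn (fun t : ℝ => F t) (Set.Ioo b t₁) :=
    hFd.continuousOn.comp Complex.continuous_ofReal.continuousOn fun t ht => by
      simpa [hU] using ht.1
  have hz : Set.EqOn (fun t : ℝ => F t) (fun _ => 0) (Set.Ioo b t₁) := by
    refine Measure.eqOn_Ioo_of_ae_eq (μ := volume) ?_ hcont continuousOn_const
    filter_upwards [h] with t ht
    rw [hFr, ht, Complex.ofReal_zero]
  have hfreq : ∃ᶠ z in 𝓝[≠] (((b + t₁) / 2 : ℝ) : ℂ), F z = 0 := by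
    have ht : Tendsto ((↑) : ℝ → ℂ) (𝓝[≠] ((b + t₁) / 2)) (𝓝[≠] (((b + t₁) / 2 : ℝ) : ℂ)) :=
      tendsto_nhdsWithin_of_tendsto_nhds_of_eventually_within _
        (Complex.continuous_ofReal.continuousAt.tendsto.mono_left nhdsWithin_le_nhds)
        (eventually_mem_nhdsWithin.mono fun t ht h => ht (Complex.ofReal_injective h))
    refine ht.frequently (Eventually.frequently ?_)
    filter_upwards [nhdsWithin_le_nhds (Ioo_mem_nhds (by linarith : b < (b + t₁) / 2)
      (by linarith : (b + t₁) / 2 < t₁))] with t h1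
    exact hz h1
  have hzero := (hFd.analyticOnNhd hUo).eqOn_zero_of_preconnected_of_frequently_eq_zero
    hUc.isPreconnected (by simp only [hU, Set.mem_ofPred_eq, Complex.ofReal_re]; linarith) hfreq
  intro t ht
  have h1 := hzero (show (t : ℂ) ∈ U from by simpa [hU] using ht)
  rw [hFr] at h1
  exact Complex.ofReal_eq_zero.mp h1

/-- An `L²(b, ∞)`-convergent exponential sum with absolutely summable coefficients converges
pointwise to the same function. -/
theorem ae_eq_tsum_of_hasSum (hμ : ∀ n, 0 < μ n)
    (hc : Summable fun n => |c n| * Real.exp (-(b - t₀) * μ n))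
    {x : Lp ℝ 2 ((volume.restrict (Set.Ioi t₀)).restrict (Set.Ioi b))}
    (hx : HasSum (fun n => c n • restrictLp t₀ (Set.Ioi b) (expLp t₀ (hμ n))) x) :
    ∀ᵐ t ∂(volume.restrict (Set.Ioi t₀)).restrict (Set.Ioi b),
      x t = ∑' n, c n * Real.exp (-μ n * (t - t₀)) := by
  -- `L²` convergence gives almost everywhere convergence along a subsequence only; this identifies
  -- the limit because the pointwise series converges absolutely.
  obtain ⟨ns, hns, hae⟩ := (tendstoInMeasure_of_tendsto_Lp hx.tendsto_sum_nat).exists_seq_tendsto_ae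
  have h1 : ∀ᵐ t ∂(volume.restrict (Set.Ioi t₀)).restrict (Set.Ioi b), ∀ N : ℕ,
      (∑ n ∈ Finset.range N, c n • restrictLp t₀ (Set.Ioi b) (expLp t₀ (hμ n)) :
        Lp ℝ 2 ((volume.restrict (Set.Ioi t₀)).restrict (Set.Ioi b))) t =
      ∑ n ∈ Finset.range N, c n * Real.exp (-μ n * (t - t₀)) := by
    rw [ae_all_iff]
    intro N
    induction N with
    | zero =>
      filter_upwards [Lp.coeFn_zero ℝ 2 ((volume.restrict (Set.Ioi t₀)).restrict (Set.Ioi b))]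
        with t ht
      simpa using ht
    | succ N ih =>
      simp only [Finset.sum_range_succ]
      filter_upwards [ih, Lp.coeFn_add (∑ n ∈ Finset.range N,
        c n • restrictLp t₀ (Set.Ioi b) (expLp t₀ (hμ n)))
        (c N • restrictLp t₀ (Set.Ioi b) (expLp t₀ (hμ N))),
        Lp.coeFn_smul (c N) (restrictLp t₀ (Set.Ioi b) (expLp t₀ (hμ N))),
        coeFn_restrictLp_expLp t₀ (Set.Ioi b) (hμ N)] with t h2 h3 h4 h5
      rw [h3, Pi.add_apply, h2, h4, Pi.smul_apply, h5, smul_eq_mul]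
  have hmem := ae_restrict_mem (μ := volume.restrict (Set.Ioi t₀))
    (measurableSet_Ioi : MeasurableSet (Set.Ioi b))
  filter_upwards [hae, h1, hmem] with t h2 h3 h4
  simp only [h3] at h2
  have h5 : Summable fun n => c n * Real.exp (-μ n * (t - t₀)) := by
    refine Summable.of_norm_bounded hc fun n => ?_
    rw [norm_mul, Real.norm_eq_abs, Real.norm_of_nonneg (Real.exp_pos _).le]
    have h6 : b < t := h4
    refine mul_le_mul_of_nonneg_left (Real.exp_le_exp.mpr ?_) (abs_nonneg _)
    nlinarith [hμ n]
  exact tendsto_nhds_unique h2 (h5.hasSum.tendsto_sum_nat.comp hns.tendsto_atTop)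

end Dirichlet

/-! ### The moment problem on a finite interval -/

section Moment

variable {μ : ℕ → ℝ} {t₀ t₁ : ℝ}

/-- An element of the closed span of the exponentials in `L²(t₀, ∞)` that vanishes on `(t₀, t₁)` is
zero. -/
theorem eq_zero_of_restrictLp_eq_zero (hμ : ∀ n, 0 < μ n) (ht : t₀ < t₁)
    {ψ : ℕ → Lp ℝ 2 (volume.restrict (Set.Ioi t₀))}
    (hψ : ∀ i j, inner ℝ (ψ i) (expLp t₀ (hμ j)) = if i = j then 1 else 0)
    (hs : ∀ δ > 0, Summable fun n => ‖ψ n‖ * Real.exp (-δ * μ n))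
    (hs' : ∀ b > t₀, Summable fun n => ‖ψ n‖ * ‖restrictLp t₀ (Set.Ioi b) (expLp t₀ (hμ n))‖)
    {x : Lp ℝ 2 (volume.restrict (Set.Ioi t₀))}
    (hx : x ∈ (Submodule.span ℝ (Set.range fun n => expLp t₀ (hμ n))).topologicalClosure)
    (hR : restrictLp t₀ (Set.Iic t₁) x = 0) : x = 0 := by
  -- The expansion of `x` is available only at a positive distance from `t₀`; the midpoint still
  -- leaves an interval `(b, t₁)` on which `x` vanishes.
  set b := (t₀ + t₁) / 2 with hb
  have hb0 : t₀ < b := by linarith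
  have hb1 : b < t₁ := by linarith
  obtain ⟨S, hS, -, hSx⟩ := hasSum_apply_of_biorthogonal hψ (restrictLp t₀ (Set.Ioi b)) (hs' b hb0)
  have h1 : HasSum (fun n => inner ℝ (ψ n) x • restrictLp t₀ (Set.Ioi b) (expLp t₀ (hμ n)))
      (restrictLp t₀ (Set.Ioi b) x) := by
    rw [← hSx x hx]
    exact hS.mapL (ContinuousLinearMap.apply ℝ _ x)
  have hc : Summable fun n => |inner ℝ (ψ n) x| * Real.exp (-(b - t₀) * μ n) := by
    refine Summable.of_nonneg_of_le (fun n => by positivity) (fun n => ?_)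
      ((hs (b - t₀) (by linarith)).mul_left ‖x‖)
    have := abs_real_inner_le_norm (ψ n) x
    calc _ ≤ ‖ψ n‖ * ‖x‖ * Real.exp (-(b - t₀) * μ n) := by gcongr
      _ = _ := by ring
  have h2 := ae_eq_tsum_of_hasSum hμ hc h1
  have h3 : ∀ᵐ t ∂volume.restrict (Set.Ioi b),
      x t = ∑' n, inner ℝ (ψ n) x * Real.exp (-μ n * (t - t₀)) := by
    rw [← restrict_restrict_Ioi hb0.le]
    filter_upwards [h2, LpToLpRestrictCLM_coeFn (F := ℝ) ℝ (Set.Ioi b) x] with t h5 h6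
    rw [← h6, h5]
  have h4 : ∀ᵐ t ∂(volume.restrict (Set.Ioi t₀)).restrict (Set.Iic t₁), x t = 0 := by
    have h5 := LpToLpRestrictCLM_coeFn (F := ℝ) ℝ (Set.Iic t₁) x
    change restrictLp t₀ (Set.Iic t₁) x =ᵐ[_] _ at h5
    rw [hR] at h5
    filter_upwards [h5, Lp.coeFn_zero ℝ 2 ((volume.restrict (Set.Ioi t₀)).restrict (Set.Iic t₁))]
      with t h6 h7
    rw [← h6, h7, Pi.zero_apply]
  have h5 := tsum_exp_eq_zero_of_ae_eq_zero hμ hc hb1 (by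
    have h6 : ∀ᵐ t ∂volume.restrict (Set.Ioo b t₁), x t = 0 := by
      rw [Measure.restrict_restrict measurableSet_Iic] at h4
      refine ae_restrict_of_ae_restrict_of_subset (fun t ht => ?_) h4
      exact ⟨ht.2.le, hb0.trans ht.1⟩
    filter_upwards [h6, ae_restrict_of_ae_restrict_of_subset Set.Ioo_subset_Ioi_self h3]
      with t h7 h8
    rw [← h8, h7])
  refine Lp.ext ?_
  have h6 : ∀ᵐ t ∂volume.restrict (Set.Ioi t₀), b < t → x t = 0 := by
    rw [← restrict_restrict_Ioi hb0.le, ae_restrict_iff' measurableSet_Ioi] at h3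
    filter_upwards [h3] with t h7 h8
    rw [h7 h8, h5 t h8]
  rw [ae_restrict_iff' measurableSet_Iic] at h4
  filter_upwards [h4, h6, Lp.coeFn_zero ℝ 2 (volume.restrict (Set.Ioi t₀))] with t h7 h8 h9
  rw [h9, Pi.zero_apply]
  rcases le_or_gt t t₁ with h | h
  · exact h7 h
  · exact h8 (hb1.trans h)

/-- Solution of the moment problem `∫_{t₀}^{t₁} e^{-μ_n (t - t₀)} ν(t) dt = m_n`. -/
theorem exists_moment_of_biorthogonal (hμ : ∀ n, 0 < μ n) (ht : t₀ < t₁)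
    {ψ : ℕ → Lp ℝ 2 (volume.restrict (Set.Ioi t₀))}
    (hψ : ∀ i j, inner ℝ (ψ i) (expLp t₀ (hμ j)) = if i = j then 1 else 0)
    (hs : ∀ δ > 0, Summable fun n => ‖ψ n‖ * Real.exp (-δ * μ n))
    (hs' : ∀ b > t₀, Summable fun n => ‖ψ n‖ * ‖restrictLp t₀ (Set.Ioi b) (expLp t₀ (hμ n))‖)
    {m : ℕ → ℝ} (hm : Summable fun n => |m n| * ‖ψ n‖) :
    ∃ ν : ℝ → ℝ, MemLp ν 2 (volume.restrict (Set.Icc t₀ t₁)) ∧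
      ∀ n, ∫ t in Set.Icc t₀ t₁, ν t * Real.exp (-μ n * (t - t₀)) = m n := by
  set X := (Submodule.span ℝ (Set.range fun n => expLp t₀ (hμ n))).topologicalClosure with hX
  have heX : ∀ n, expLp t₀ (hμ n) ∈ X := fun n =>
    Submodule.le_topologicalClosure _ (Submodule.subset_span ⟨n, rfl⟩)
  obtain ⟨S, -, hS, hSx⟩ := hasSum_apply_of_biorthogonal hψ (restrictLp t₀ (Set.Ioi t₁)) (hs' t₁ ht)
  -- Compactness comes from passing to `X`, where the restriction to the tail coincides with the
  -- compact operator `S`.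
  have hG : IsCompactOperator ((restrictLp t₀ (Set.Ioi t₁)).comp X.subtypeL) := by
    have h1 : (restrictLp t₀ (Set.Ioi t₁)).comp X.subtypeL = S.comp X.subtypeL := by
      ext1 x
      exact (hSx x x.2).symm
    rw [h1]
    exact hS.comp_clm X.subtypeL
  have hsum : Summable fun n => m n • ψ n := by
    refine Summable.of_norm ?_
    simpa only [norm_smul, Real.norm_eq_abs] using hm
  set y := ∑' n, m n • ψ n with hy
  have hye : ∀ n, inner ℝ y (expLp t₀ (hμ n)) = m n := by
    intro n
    rw [real_inner_comm]
    have h1 : HasSum (fun i => inner ℝ (expLp t₀ (hμ n)) (m i • ψ i)) (inner ℝ (expLp t₀ (hμ n)) y) :=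
      hsum.hasSum.mapL (innerSL ℝ (expLp t₀ (hμ n)))
    refine h1.unique ?_
    convert hasSum_ite_eq n (m n) using 2 with i
    rw [inner_smul_right, real_inner_comm, hψ]
    split_ifs with h
    · rw [h, mul_one]
    · rw [mul_zero]
  -- Only the functional induced by `y` on `X` matters, so its Riesz representative in `X` takes the
  -- place of `y`.
  obtain ⟨z, hz⟩ := exists_inner_eq_of_isCompactOperator
    ((restrictLp t₀ (Set.Iic t₁)).comp X.subtypeL) ((restrictLp t₀ (Set.Ioi t₁)).comp X.subtypeL) hG
    (fun x x' => inner_eq_add_inner_restrictLp t₀ t₁ x x')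
    (fun x hx => Subtype.ext (eq_zero_of_restrictLp_eq_zero hμ ht hψ hs hs' x.2 hx))
    ((InnerProductSpace.toDual ℝ X).symm ((innerSL ℝ y).comp X.subtypeL))
  have hmeas : (volume.restrict (Set.Ioi t₀)).restrict (Set.Iic t₁) =
      volume.restrict (Set.Icc t₀ t₁) := by
    rw [Measure.restrict_restrict measurableSet_Iic, Set.inter_comm, Set.Ioi_inter_Iic,
      Measure.restrict_congr_set Ioc_ae_eq_Icc]
  refine ⟨(z : Lp ℝ 2 (volume.restrict (Set.Ioi t₀))), ?_, fun n => ?_⟩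
  · rw [← hmeas]
    exact (Lp.memLp _).restrict _
  · have h1 := hz ⟨_, heX n⟩
    rw [InnerProductSpace.toDual_symm_apply] at h1
    change inner ℝ (restrictLp t₀ (Set.Iic t₁) z) (restrictLp t₀ (Set.Iic t₁) (expLp t₀ (hμ n))) =
      inner ℝ y (expLp t₀ (hμ n)) at h1
    rw [hye, inner_restrictLp, hmeas] at h1
    rw [← h1, ← hmeas]
    refine integral_congr_ae ?_
    filter_upwards [ae_restrict_of_ae (coeFn_expLp t₀ (hμ n))] with t h2
    rw [h2, real_inner_eq_re_inner, RCLike.inner_apply]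
    simp only [conj_trivial, RCLike.re_to_real]
    ring

theorem exists_moment (hpos : ∀ n, 0 < μ n) (hmono : StrictMono μ) {a b β : ℝ} (ha : 0 < a)
    (hb : 0 < b) (hβ : 1 < β)
    (hab : ∀ n : ℕ, a * ((n : ℝ) + 1) ^ β ≤ μ n ∧ μ n ≤ b * ((n : ℝ) + 1) ^ β)
    {θ s : ℝ} (hθ : 0 < θ) (hs : 0 ≤ s)
    (hgap : ∀ n : ℕ, θ * ((n : ℝ) + 1) ^ (-s) ≤ μ (n + 1) - μ n) (ht : t₀ < t₁)
    {m : ℕ → ℝ} {Q P α δ : ℝ} (hα : α < β) (hδ : 0 < δ)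
    (hm : ∀ n : ℕ, |m n| ≤ Q * Real.exp (P * ((n : ℝ) + 1) ^ α - δ * μ n)) :
    ∃ ν : ℝ → ℝ, MemLp ν 2 (volume.restrict (Set.Icc t₀ t₁)) ∧
      ∀ n, ∫ t in Set.Icc t₀ t₁, ν t * Real.exp (-μ n * (t - t₀)) = m n := by
  obtain ⟨γ, hγ, Λ, hΛ⟩ := exists_prod_le_exp hpos hmono ha hb hβ hab hθ hs hgap
  obtain ⟨ψ, hψ, hψe⟩ := exists_biorthogonal (e := fun n => expLp t₀ (hpos n)) hpos
    hmono.injective (fun i j => inner_expLp t₀ (hpos i) (hpos j)) hΛ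
  have hsum : ∀ P : ℝ, ∀ δ > 0,
      Summable fun n : ℕ => ‖ψ n‖ * Real.exp (P * ((n : ℝ) + 1) ^ α - δ * μ n) := by
    intro P δ hδ
    refine Summable.of_nonneg_of_le (fun n => by positivity) (fun n => ?_)
      ((summable_exp_rpow_sub_rpow (Λ := Λ) (P := P) hβ hγ hα
        (by positivity : 0 < δ / 2 * a)).mul_left (Real.sqrt (2 / δ)))
    have hμn := hpos n
    have hen := norm_expLp_sq t₀ hμn
    -- Half of the decay absorbs `1/‖e_n‖ = √(2 μ_n)`, through `2 μ_n ≤ (2/δ) e^{δ μ_n}`; the other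
    -- half is left to dominate the powers `γ` and `α`.
    have h1 : 1 ≤ Real.sqrt (2 / δ) * Real.exp (δ / 2 * μ n) * ‖expLp t₀ hμn‖ := by
      rw [← one_le_sq_iff₀ (by positivity), mul_pow, mul_pow, hen, Real.sq_sqrt (by positivity),
        sq (Real.exp _), ← Real.exp_add]
      have h2 := Real.add_one_le_exp (δ / 2 * μ n + δ / 2 * μ n)
      have h3 : δ * μ n ≤ Real.exp (δ / 2 * μ n + δ / 2 * μ n) := by linarith
      calc (1 : ℝ) = 2 / δ * (δ * μ n) * (1 / (2 * μ n)) := by field_simp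
        _ ≤ _ := by gcongr
    have h4 : ‖ψ n‖ ≤ Real.sqrt (2 / δ) * Real.exp (δ / 2 * μ n) *
        Real.exp (Λ * ((n : ℝ) + 1) ^ γ) := by
      calc ‖ψ n‖ ≤ ‖ψ n‖ * (Real.sqrt (2 / δ) * Real.exp (δ / 2 * μ n) * ‖expLp t₀ hμn‖) :=
            le_mul_of_one_le_right (norm_nonneg _) h1
        _ = Real.sqrt (2 / δ) * Real.exp (δ / 2 * μ n) * (‖ψ n‖ * ‖expLp t₀ hμn‖) := by ring
        _ ≤ _ := by have := hψe n; gcongr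
    have h5 := mul_le_mul_of_nonneg_left (hab n).1 (by positivity : 0 ≤ δ / 2)
    calc ‖ψ n‖ * Real.exp (P * ((n : ℝ) + 1) ^ α - δ * μ n)
        ≤ Real.sqrt (2 / δ) * Real.exp (δ / 2 * μ n) * Real.exp (Λ * ((n : ℝ) + 1) ^ γ) *
          Real.exp (P * ((n : ℝ) + 1) ^ α - δ * μ n) := by gcongr
      _ = Real.sqrt (2 / δ) * Real.exp (δ / 2 * μ n + Λ * ((n : ℝ) + 1) ^ γ +
          (P * ((n : ℝ) + 1) ^ α - δ * μ n)) := by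
          rw [Real.exp_add, Real.exp_add]; ring
      _ ≤ _ := by
          gcongr
          linarith
  have hs0 : ∀ δ > 0, Summable fun n => ‖ψ n‖ * Real.exp (-δ * μ n) := fun δ hδ => by
    simpa using hsum 0 δ hδ
  refine exists_moment_of_biorthogonal hpos ht hψ hs0 (fun b hb => ?_) ?_
  · refine Summable.of_nonneg_of_le (fun n => by positivity) (fun n => ?_)
      ((hs0 (b - t₀) (by linarith)).mul_right ‖expLp t₀ (hpos 0)‖)
    rw [norm_restrictLp_expLp hb.le, mul_assoc]
    have h1 : ‖expLp t₀ (hpos n)‖ ≤ ‖expLp t₀ (hpos 0)‖ := by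
      rw [← sq_le_sq₀ (norm_nonneg _) (norm_nonneg _), norm_expLp_sq, norm_expLp_sq]
      have := hpos 0
      have := hmono.monotone n.zero_le
      gcongr
    gcongr
  · refine Summable.of_nonneg_of_le (fun n => by positivity) (fun n => ?_)
      ((hsum P δ hδ).mul_left Q)
    calc |m n| * ‖ψ n‖ ≤ Q * Real.exp (P * ((n : ℝ) + 1) ^ α - δ * μ n) * ‖ψ n‖ := by
          gcongr; exact hm n
      _ = _ := by ring

end Moment

/-! ### Solutions of the evolution equation and Moore–Penrose inverses -/

/-- Symmetry turns the equation into `y' = -μ y` for the coefficient `y` along `φ`, so `e^{μ s}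
y(s)` is constant. Differentiability on the open interval and continuity at both ends suffice for
the mean value theorem. -/
theorem inner_eq_of_isSolution {H : Type*} [NormedAddCommGroup H] [InnerProductSpace ℝ H]
    [CompleteSpace H] {A : H →ₗ.[ℝ] H} (hA : IsSelfAdjoint A) {φ : H} {μ : ℝ}
    (hφ : (φ, μ • φ) ∈ A.graph) {T : EReal} {g : H} {u : ℝ → H} (hu : IsSolution A T g u) {t : ℝ}
    (ht : 0 ≤ t) (htT : (t : EReal) ≤ T) :
    inner ℝ φ (u t) = Real.exp (-μ * t) * inner ℝ φ g := by
  obtain ⟨φ', rfl, hφ'⟩ := (LinearPMap.mem_graph_iff A).mp hφ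
  have hsymm : ∀ x : A.domain, inner ℝ (φ' : H) (A x) = μ * inner ℝ (φ' : H) (x : H) := by
    intro x
    have h1 := LinearPMap.adjoint_isFormalAdjoint hA.dense_domain
    rw [LinearPMap.isSelfAdjoint_def.mp hA] at h1
    rw [← h1 φ' x, hφ', real_inner_smul_left]
  rcases ht.eq_or_lt with rfl | ht0
  · rw [hu.initial]; simp
  have hsub : Set.Icc 0 t ⊆ {s : ℝ | 0 ≤ s ∧ (s : EReal) ≤ T} := fun s hs =>
    ⟨hs.1, (EReal.coe_le_coe_iff.mpr hs.2).trans htT⟩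
  have hderiv : ∀ s ∈ Set.Ioo 0 t,
      HasDerivAt (fun s => Real.exp (μ * s) * inner ℝ (φ' : H) (u s)) 0 s := by
    intro s hs
    obtain ⟨hdom, hd⟩ := hu.equation s hs.1 ((EReal.coe_le_coe_iff.mpr hs.2.le).trans htT)
    have hd' := hd.hasDerivAt (mem_of_superset (Icc_mem_nhds hs.1 hs.2) hsub)
    have h1 : HasDerivAt (fun s => Real.exp (μ * s)) (Real.exp (μ * s) * (μ * 1)) s :=
      ((hasDerivAt_id s).const_mul μ).exp
    have h2 := h1.mul ((hasDerivAt_const s (φ' : H)).inner ℝ hd')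
    refine h2.congr_deriv ?_
    rw [inner_neg_right, hsymm ⟨u s, hdom⟩, inner_zero_left]
    ring
  have hcont : ContinuousOn (fun s => Real.exp (μ * s) * inner ℝ (φ' : H) (u s)) (Set.Icc 0 t) := by
    have := hu.continuousOn.mono hsub
    fun_prop
  obtain ⟨s, -, hs⟩ := exists_hasDerivAt_eq_slope _ _ ht0 hcont hderiv
  rw [eq_comm, div_eq_zero_iff, sub_eq_zero, hu.initial, mul_zero, Real.exp_zero, one_mul] at hs
  rw [← hs.resolve_right (by linarith), ← mul_assoc, ← Real.exp_add]
  simp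

/-- Full column rank makes `B` injective, so `B` can be cancelled on the left of `B X B = B`. -/
theorem IsMoorePenroseInverse.mul_eq_one {ι κ : Type*} [Fintype ι] [Fintype κ] [DecidableEq κ]
    {B : Matrix ι κ ℝ} {X : Matrix κ ι ℝ} (h : IsMoorePenroseInverse B X)
    (hB : B.rank = Fintype.card κ) : X * B = 1 := by
  have hker : LinearMap.ker B.mulVecLin = ⊥ := by
    have h1 := LinearMap.finrank_range_add_finrank_ker B.mulVecLin
    rw [← Matrix.rank, hB, Module.finrank_fintype_fun_eq_card] at h1
    exact Submodule.finrank_eq_zero.mp (by omega)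
  refine Matrix.toLin'.injective (LinearMap.ext fun v => ?_)
  refine LinearMap.ker_eq_bot.mp hker ?_
  simp only [Matrix.mulVecLin_apply, Matrix.toLin'_apply, Matrix.one_mulVec, Matrix.mulVec_mulVec]
  rw [← Matrix.mul_assoc, h.mul_mul_self]

theorem abs_apply_le_l2_opNorm {ι κ : Type*} [Fintype ι] [Fintype κ] [DecidableEq κ]
    (X : Matrix ι κ ℝ) (i : ι) (j : κ) : |X i j| ≤ ‖X‖ := by
  have h1 := Matrix.l2_opNorm_mulVec X (EuclideanSpace.single j 1)
  rw [PiLp.norm_single, norm_one, mul_one] at h1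
  refine le_trans ?_ h1
  have h2 := PiLp.norm_apply_le (WithLp.toLp 2 (X.mulVec (EuclideanSpace.single j (1 : ℝ)).ofLp)) i
  simpa using h2

end EllipticEvolution

/-! ### Reduction of the representation to moment problems -/

theorem mainTheorem3
    -- the evolution operator: a strongly elliptic operator on a bounded open set, self-adjoint
    -- under the homogeneous boundary condition `V`
    (k : ℕ) (Ω : TopologicalSpace.Opens (EuclideanSpace ℝ (Fin k)))
    (hΩ : Bornology.IsBounded (Ω : Set (EuclideanSpace ℝ (Fin k))))
    (m : ℕ) (c : (Fin k → ℕ) → EuclideanSpace ℝ (Fin k) → ℝ)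
    (hell : EllipticEvolution.IsStronglyElliptic Ω m c)
    (V : Submodule ℝ (EllipticEvolution.L2 Ω))
    (hsa : IsSelfAdjoint (EllipticEvolution.operator Ω m c V))
    -- the eigenvalue at index `n` is the `(n + 1)`-st; its multiplicity is `d n`
    (μ : ℕ → ℝ) (hμpos : 0 < μ 0) (hμmono : StrictMono μ)
    (D : ℕ) (d : ℕ → ℕ) (hd : ∀ n, 1 ≤ d n) (hdD : ∀ n, d n ≤ D)
    (φ : HilbertBasis (Σ n : ℕ, Fin (d n)) ℝ (EllipticEvolution.L2 Ω))
    (hφ : ∀ (n : ℕ) (l : Fin (d n)),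
      (φ ⟨n, l⟩, μ n • φ ⟨n, l⟩) ∈ (EllipticEvolution.operator Ω m c V).graph)
    -- growth and separation of the eigenvalues
    (M β σ : ℝ) (hM : 0 < M) (hβ : 1 < β) (hσ : 0 < σ) (hσ1 : σ ≤ 1)
    (hgrowth : (fun n : ℕ => μ n / (M * ((n : ℝ) + 1) ^ β) - 1)
      =o[atTop] fun n : ℕ => ((n : ℝ) + 1) ^ (-σ))
    (θ s : ℝ) (hθ : 0 < θ) (hs : 0 ≤ s)
    (hgap : ∀ n : ℕ, θ * ((n : ℝ) + 1) ^ (-s) ≤ μ (n + 1) - μ n)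
    -- the sample initial data and their coefficient matrices
    (g : Fin D → EllipticEvolution.L2 Ω)
    (B : (n : ℕ) → Matrix (Fin D) (Fin (d n)) ℝ)
    (hB : ∀ (n : ℕ) (j : Fin D) (l : Fin (d n)), B n j l = inner ℝ (φ ⟨n, l⟩) (g j))
    (hrank : ∀ n, (B n).rank = d n)
    (Bdag : (n : ℕ) → Matrix (Fin (d n)) (Fin D) ℝ)
    (hBdag : ∀ n, EllipticEvolution.IsMoorePenroseInverse (B n) (Bdag n))
    (L p α : ℝ) (hα : 0 ≤ α) (hαβ : α < β)
    (hbound : ∀ n : ℕ, ‖Bdag n‖ ≤ L * Real.exp (p * ((n : ℝ) + 1) ^ α))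
    -- the solutions
    (T : EReal) (f : EllipticEvolution.L2 Ω)
    (u : Fin D → ℝ → EllipticEvolution.L2 Ω) (w : ℝ → EllipticEvolution.L2 Ω)
    (hu : ∀ j, EllipticEvolution.IsSolution (EllipticEvolution.operator Ω m c V) T (g j) (u j))
    (hw : EllipticEvolution.IsSolution (EllipticEvolution.operator Ω m c V) T f w)
    (t₀ t₁ τ : ℝ) (ht₀ : 0 ≤ t₀) (ht₀₁ : t₀ < t₁) (ht₁T : (t₁ : EReal) ≤ T)
    (hτ : t₀ < τ) (hτT : (τ : EReal) ≤ T) :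
    ∃ ν : Fin D → ℝ → ℝ,
      (∀ j, MemLp (ν j) 2 (volume.restrict (Set.Icc t₀ t₁))) ∧
      (∀ j, IntegrableOn (fun t => ν j t • u j t) (Set.Icc t₀ t₁) volume) ∧
      w τ = ∑ j, ∫ t in Set.Icc t₀ t₁, ν j t • u j t := by
  have hμ : ∀ n, 0 < μ n := fun n => hμpos.trans_le (hμmono.monotone n.zero_le)
  obtain ⟨a, ha, b, hb, hab⟩ : ∃ a > 0, ∃ b > 0, ∀ n : ℕ,
      a * ((n : ℝ) + 1) ^ β ≤ μ n ∧ μ n ≤ b * ((n : ℝ) + 1) ^ β := by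
    refine EllipticEvolution.exists_rpow_bounds hμ hM ?_
    have h1 : Tendsto (fun n : ℕ => ((n : ℝ) + 1) ^ (-σ)) atTop (𝓝 0) :=
      (tendsto_rpow_neg_atTop hσ).comp
        (tendsto_atTop_add_const_right _ _ tendsto_natCast_atTop_atTop)
    simpa using (hgrowth.trans_tendsto h1).add_const 1
  -- The rows `r n` satisfy `r n * B n = f_n` once `Bdag n * B n = 1`; the norm bound on `Bdag n`
  -- controls their growth.
  set r : (n : ℕ) → Fin D → ℝ := fun n j => ∑ l, Bdag n l j * inner ℝ (φ ⟨n, l⟩) f with hr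
  have hrle : ∀ n j, |r n j| ≤ D * L * ‖f‖ * Real.exp (p * ((n : ℝ) + 1) ^ α) := by
    intro n j
    have h1 : ∀ l ∈ Finset.univ, |Bdag n l j * inner ℝ (φ ⟨n, l⟩) f| ≤ ‖Bdag n‖ * ‖f‖ := by
      intro l _
      rw [abs_mul]
      have h2 := abs_real_inner_le_norm (φ ⟨n, l⟩) f
      rw [φ.orthonormal.1, one_mul] at h2
      exact mul_le_mul (EllipticEvolution.abs_apply_le_l2_opNorm _ _ _) h2 (abs_nonneg _)
        (norm_nonneg _)
    have h3 : (d n : ℝ) ≤ D := by exact_mod_cast hdD n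
    calc |r n j| ≤ ∑ l, |Bdag n l j * inner ℝ (φ ⟨n, l⟩) f| := Finset.abs_sum_le_sum_abs _ _
      _ ≤ d n * (‖Bdag n‖ * ‖f‖) := by
          refine (Finset.sum_le_card_nsmul _ _ _ h1).trans_eq ?_
          rw [Finset.card_univ, Fintype.card_fin, nsmul_eq_mul]
      _ ≤ D * (L * Real.exp (p * ((n : ℝ) + 1) ^ α) * ‖f‖) := by
          have := hbound n
          gcongr
      _ = _ := by ring
  -- The hypothesis `t₀ < τ` supplies the decay rate `δ = τ - t₀` of the moments; the position of
  -- `τ` relative to `t₁` plays no role.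
  have hmoment : ∀ j, ∃ ν : ℝ → ℝ, MemLp ν 2 (volume.restrict (Set.Icc t₀ t₁)) ∧
      ∀ n, ∫ t in Set.Icc t₀ t₁, ν t * Real.exp (-μ n * (t - t₀)) =
        Real.exp (-μ n * (τ - t₀)) * r n j := by
    intro j
    refine EllipticEvolution.exists_moment hμ hμmono ha hb hβ hab hθ hs hgap ht₀₁ hαβ
      (sub_pos.mpr hτ) (Q := D * L * ‖f‖) (P := p) fun n => ?_
    rw [abs_mul, Real.abs_exp]
    calc _ ≤ Real.exp (-μ n * (τ - t₀)) * (D * L * ‖f‖ * Real.exp (p * ((n : ℝ) + 1) ^ α)) := by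
          gcongr
          exact hrle n j
      _ = D * L * ‖f‖ * (Real.exp (p * ((n : ℝ) + 1) ^ α) * Real.exp (-μ n * (τ - t₀))) := by ring
      _ = _ := by rw [← Real.exp_add]; congr 2; ring
  choose ν hν hνm using hmoment
  have hT : ∀ t ∈ Set.Icc t₀ t₁, (t : EReal) ≤ T := fun t ht =>
    (EReal.coe_le_coe_iff.mpr ht.2).trans ht₁T
  have hint : ∀ j, IntegrableOn (fun t => ν j t • u j t) (Set.Icc t₀ t₁) volume := by
    intro j
    have h1 : IntegrableOn (ν j) (Set.Icc t₀ t₁) volume := (hν j).integrable (by norm_num)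
    exact h1.smul_continuousOn
      ((hu j).continuousOn.mono fun t ht => ⟨ht₀.trans ht.1, hT t ht⟩) isCompact_Icc
  refine ⟨ν, hν, hint, φ.repr.injective (lp.ext (funext fun i => ?_))⟩
  obtain ⟨n, l⟩ := i
  rw [φ.repr_apply_apply, φ.repr_apply_apply, inner_sum,
    EllipticEvolution.inner_eq_of_isSolution hsa (hφ n l) hw (ht₀.trans hτ.le) hτT]
  have hterm : ∀ j, inner ℝ (φ ⟨n, l⟩) (∫ t in Set.Icc t₀ t₁, ν j t • u j t) =
      Real.exp (-μ n * τ) * (r n j * B n j l) := by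
    intro j
    rw [← integral_inner (hint j)]
    have h1 : ∀ t ∈ Set.Icc t₀ t₁, inner ℝ (φ ⟨n, l⟩) (ν j t • u j t) =
        Real.exp (-μ n * t₀) * B n j l * (ν j t * Real.exp (-μ n * (t - t₀))) := by
      intro t ht
      rw [real_inner_smul_right, EllipticEvolution.inner_eq_of_isSolution hsa (hφ n l) (hu j)
        (ht₀.trans ht.1) (hT t ht), hB,
        show -μ n * t = -μ n * t₀ + -μ n * (t - t₀) by ring, Real.exp_add]
      ring
    rw [setIntegral_congr_fun measurableSet_Icc h1, integral_const_mul, hνm,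
      show -μ n * τ = -μ n * t₀ + -μ n * (τ - t₀) by ring, Real.exp_add]
    ring
  have hone : Bdag n * B n = 1 := (hBdag n).mul_eq_one (by rw [hrank, Fintype.card_fin])
  simp_rw [hterm]
  rw [← Finset.mul_sum]
  congr 1
  calc inner ℝ (φ ⟨n, l⟩) f = ∑ l', (Bdag n * B n) l' l * inner ℝ (φ ⟨n, l'⟩) f := by
        rw [hone, Finset.sum_eq_single l]
        · rw [Matrix.one_apply_eq, one_mul]
        · intro l' _ h
          rw [Matrix.one_apply_ne h, zero_mul]
        · exact fun h => absurd (Finset.mem_univ l) h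
    _ = ∑ j, r n j * B n j l := by
        simp_rw [Matrix.mul_apply, hr, Finset.sum_mul]
        rw [Finset.sum_comm]
        refine Finset.sum_congr rfl fun j _ => Finset.sum_congr rfl fun l' _ => ?_
        ring
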